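/- **Setting.** Consider a finite polygonal mesh with cells $i$, edges $e$, vertices $j$ on a closed oriented surface (no boundary) made of flat triangular facets, in which every edge joins two different vertices and separates two different cells, together with its dual mesh. The dual vertex $i$ lies in the primal cell $i$, and the primal edge $e$ meets the dual edge $e$ at a point $x_e$; joining each dual vertex to the vertices and to the points $x_e$ on the boundary of its cell divides every $n$-gon, primal or dual, into $2n$ flat nondegenerate triangles, which are the facets (the supermesh). Let $\mathbf k$ be the unit normal of the surface. Every primal edge carries a unit tangent $\mathbf t$ and unit normal $\mathbf n$ with $\mathbf t=\mathbf k\times\mathbf n$; the unit tangent $\mathbf m$ of the dual edge points to the side to which $\mathbf n$ points. Put $t_{ej}=1$ (resp. $-1$) if $e$ is incident on $j$ and $\mathbf t$ points towards (resp. away from) $j$, and $n_{ei}=1$ (resp. $-1$) if $\mathbf n$ points out of (resp. into) cell $i$, and $0$ otherwise; $D_1=(t_{ej})$, $D_2=(n_{ei})^T$, $\overline D_1=-D_2^T$, $\overline D_2=D_1^T$. **Compound elements.** $\mathbf V_0$ consists of the continuous piecewise linear functions on the supermesh whose tangential derivative is constant along each primal edge and which are discretely harmonic in each cell (the integral over the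 cell of $\nabla\psi\cdot\nabla\eta$ vanishes for all continuous piecewise linear $\eta$ that vanish on the primal edges). $\mathbf V_1$ consists of the lowest order Raviart–Thomas fields on the supermesh whose normal component is constant along each primal edge, whose divergence is constant in each cell, and whose discrete curl vanishes in each cell (the integral over the cell of $\mathbf u\cdot\nabla^\perp\eta$ vanishes for the same $\eta$). $\mathbf V_2$ consists of the functions that are constant on each cell. $\mathbf V^0$ and $\mathbf V^2$ are the spaces $\mathbf V_0$ and $\mathbf V_2$ of the dual mesh, and $\mathbf V^1$ consists of the fields $\mathbf k\times\mathbf u$ with $\mathbf u$ in the space $\mathbf V_1$ of the dual mesh. **Claim.** There are unique families $\alpha_i\in\mathbf V_2$, $\mathbf v_e\in\mathbf V_1$, $\gamma_j\in\mathbf V_0$, $\beta_j\in\mathbf V^2$, $\mathbf w_e\in\mathbf V^1$, $\chi_i\in\mathbf V^0$ with $\int_{\text{cell }i'}\alpha_i\,dA=\delta_{ii'}$, $\int_{\text{edge }e'}\mathbf v_e\cdot\mathbf n\,dl=\delta_{ee'}$, $\gamma_j(\text{vertex }j')=\delta_{jj'}$, $\int_{\text{dual cell }j'}\beta_j\,dA=\delta_{jj'}$,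 $\int_{\text{dual edge }e'}\mathbf w_e\cdot\mathbf m\,dl=\delta_{ee'}$, $\chi_i(\text{dual vertex }i')=\delta_{ii'}$. With the $L^2$ inner product $\langle\cdot,\cdot\rangle$ let $L=\langle\alpha_i,\alpha_{i'}\rangle$, $M=\langle\mathbf v_e,\mathbf v_{e'}\rangle$, $N=\langle\gamma_j,\gamma_{j'}\rangle$ be the mass matrices and $H=\langle\mathbf v_e,\mathbf w_{e'}\rangle$, $J=\langle\gamma_j,\beta_{j'}\rangle$, $I=\langle\alpha_i,\chi_{i'}\rangle$ the discrete Hodge star matrices. Then $$\overline D_2H=J\overline D_2,\qquad \overline D_1I=H\overline D_1 .$$ Here $\overline D_1$ and $\overline D_2$ represent strong derivatives: on every facet $\nabla\sum_i\hat p_i\chi_i=\sum_e(\overline D_1\hat P)_e\mathbf w_e$ and $\mathbf k\cdot\nabla\times\sum_e\hat u_e\mathbf w_e=\sum_j(\overline D_2\hat U)_j\beta_j$. The matrices $L,M,N$ are invertible; $M^{-1}\overline D_1L$ is the matrix of the weak gradient $\mathbf V_2\to\mathbf V_1$ (defined by $\langle\mathbf u,\mathbf g\rangle=-\langle\nabla\cdot\mathbf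 u,\phi\rangle$ for all $\mathbf u\in\mathbf V_1$) and $N^{-1}\overline D_2M$ that of the weak curl $\mathbf V_1\to\mathbf V_0$ (defined by $\langle\psi,\xi\rangle=-\langle\nabla^\perp\psi,\mathbf u\rangle$ for all $\psi\in\mathbf V_0$). They factor as a Hodge star, a dual strong derivative, and a Hodge star back: $$M^{-1}\overline D_1L=(M^{-1}H)\,\overline D_1\,(I^{-1}L)\ \text{ if } I \text{ is invertible},\qquad N^{-1}\overline D_2M=(N^{-1}J)\,\overline D_2\,(H^{-1}M)\ \text{ if } H\text{ is invertible}.$$ -/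

import Mathlib

open MeasureTheory Matrix

noncomputable section

namespace CompoundFE

/-- The Euclidean plane, in which every flat triangular facet is drawn. -/
abbrev Plane : Type := EuclideanSpace ℝ (Fin 2)

/-- The operation `a ↦ k × a`: rotation by a right angle, counterclockwise. -/
def rot (a : Plane) : Plane := !₂[-(a 1), a 0]

/-- The planar cross product `k · (a × b)`. -/
def cross (a b : Plane) : ℝ := a 0 * b 1 - a 1 * b 0

/-- Unit tangent of the segment directed from `A` to `B`. -/
def unitTangent (A B : Plane) : Plane := (dist A B)⁻¹ • (B - A)

/-- Unit normal `n` of the segment directed from `A` to `B`, with `t = k × n`. -/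
def unitNormal (A B : Plane) : Plane := -rot (unitTangent A B)

/-- Line integral over the segment from `A` to `B` with respect to arc length. -/
def lineIntegral (A B : Plane) (g : Plane → ℝ) : ℝ :=
  (∫ t in (0 : ℝ)..1, g (AffineMap.lineMap A B t)) * dist A B

/-- Divergence of a planar vector field. -/
def pdiv (u : Plane → Plane) (x : Plane) : ℝ :=
  fderiv ℝ u x (EuclideanSpace.single 0 1) 0 + fderiv ℝ u x (EuclideanSpace.single 1 1) 1

/-- Scalar curl `k · ∇ × u` of a planar vector field. -/
def pcurl (u : Plane → Plane) (x : Plane) : ℝ :=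
  fderiv ℝ u x (EuclideanSpace.single 0 1) 1 - fderiv ℝ u x (EuclideanSpace.single 1 1) 0

/-- A polygonal mesh on a closed oriented surface made of flat triangular facets, with its dual mesh
and the common supermesh of triangular subelements.

`V`, `E`, `C` are the primal vertices, edges and cells.  The primal edge `e` and its dual edge cross
at a point `x_e`; joining the dual vertex (centre) of every cell to the vertices and to the points
`x_e` on the boundary of the cell divides an `n`-gon into `2n` triangles.  `F` is the set of these
triangles: `f : F` has corners at the primal vertex `vtx f`, at the crossing point of the edge
`edge f`, and at the centre of the cell `cell f`.  The triangles adjacent to `f` are `ρ₀ f` (across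
the side opposite to the primal vertex), `ρ₁ f` (across the side opposite to the edge point) and
`ρ₂ f` (across the side opposite to the cell centre).

Facet `f` is drawn in the plane, compatibly with the orientation `k` of the surface, with corners
`pt₀ f` (primal vertex), `pt₁ f` (edge point), `pt₂ f` (cell centre); facets are glued by
isometries along sides.  A polyhedral surface in space and a flat periodic domain are special
cases. -/
structure Mesh (F V E C : Type*) where
  vtx : F → V
  edge : F → E
  cell : F → C
  ρ₀ : F → F
  ρ₁ : F → F
  ρ₂ : F → F
  ρ₀_invol : ∀ f, ρ₀ (ρ₀ f) = f
  ρ₁_invol : ∀ f, ρ₁ (ρ₁ f) = f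
  ρ₂_invol : ∀ f, ρ₂ (ρ₂ f) = f
  ρ_comm : ∀ f, ρ₀ (ρ₂ f) = ρ₂ (ρ₀ f)
  vtx_surj : Function.Surjective vtx
  edge_surj : Function.Surjective edge
  cell_surj : Function.Surjective cell
  /-- The triangles around a primal vertex form one cycle. -/
  vtx_eq_iff : ∀ f g, vtx f = vtx g ↔ Relation.ReflTransGen (fun a b => b = ρ₁ a ∨ b = ρ₂ a) f g
  /-- The four triangles at an edge. -/
  edge_eq_iff : ∀ f g, edge f = edge g ↔ (g = f ∨ g = ρ₀ f ∨ g = ρ₂ f ∨ g = ρ₀ (ρ₂ f))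
  /-- The triangles around the centre of a primal cell form one cycle. -/
  cell_eq_iff : ∀ f g, cell f = cell g ↔ Relation.ReflTransGen (fun a b => b = ρ₁ a ∨ b = ρ₀ a) f g
  /-- An edge joins two different vertices. -/
  vtx_ne : ∀ f, vtx (ρ₀ f) ≠ vtx f
  /-- An edge separates two different cells. -/
  cell_ne : ∀ f, cell (ρ₂ f) ≠ cell f
  /-- `+1` if edge point, primal vertex, cell centre run counterclockwise around the triangle. -/
  sgn : F → ℤˣ
  sgn_ρ₀ : ∀ f, sgn (ρ₀ f) = -sgn f
  sgn_ρ₁ : ∀ f, sgn (ρ₁ f) = -sgn f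
  sgn_ρ₂ : ∀ f, sgn (ρ₂ f) = -sgn f
  /-- The choice of a tangent direction `t` of every primal edge: `+1` if `t` at `edge f` points
  towards `vtx f`, and `-1` if it points away. -/
  head : F → ℤˣ
  head_ρ₀ : ∀ f, head (ρ₀ f) = -head f
  head_ρ₂ : ∀ f, head (ρ₂ f) = head f
  pt₀ : F → Plane
  pt₁ : F → Plane
  pt₂ : F → Plane
  /-- The facets are nondegenerate and drawn with the right orientation. -/
  oriented : ∀ f, 0 < ((sgn f : ℤ) : ℝ) * cross (pt₀ f - pt₁ f) (pt₂ f - pt₁ f)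
  glue_ρ₀ : ∀ f, dist (pt₁ (ρ₀ f)) (pt₂ (ρ₀ f)) = dist (pt₁ f) (pt₂ f)
  glue_ρ₁ : ∀ f, dist (pt₀ (ρ₁ f)) (pt₂ (ρ₁ f)) = dist (pt₀ f) (pt₂ f)
  glue_ρ₂ : ∀ f, dist (pt₀ (ρ₂ f)) (pt₁ (ρ₂ f)) = dist (pt₀ f) (pt₁ f)

/-- A scalar field: one function per facet, of which only the values on the facet matter (all
fields below are polynomials on each facet, and are identified with these polynomials). -/
abbrev SField (F : Type*) : Type _ := F → Plane → ℝ

/-- A tangential vector field: one planar vector field per facet. -/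
abbrev VField (F : Type*) : Type _ := F → Plane → Plane

/-- Facetwise gradient. -/
def grad {F : Type*} (q : SField F) : VField F := fun f => gradient (q f)

/-- Facetwise `∇^⊥ = k × ∇`. -/
def gradPerp {F : Type*} (q : SField F) : VField F := fun f x => rot (grad q f x)

/-- Facetwise divergence. -/
def div {F : Type*} (u : VField F) : SField F := fun f => pdiv (u f)

/-- Facetwise curl `k · ∇ ×`. -/
def curl {F : Type*} (u : VField F) : SField F := fun f => pcurl (u f)

namespace Mesh

variable {F V E C : Type*}

/-- The dual mesh: cells and vertices are exchanged.  The tangent of the dual edge is the vector `m`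
pointing to the side to which the normal `n` of the primal edge points. -/
def dual (S : Mesh F V E C) : Mesh F C E V where
  vtx := S.cell
  edge := S.edge
  cell := S.vtx
  ρ₀ := S.ρ₂
  ρ₁ := S.ρ₁
  ρ₂ := S.ρ₀
  ρ₀_invol := S.ρ₂_invol
  ρ₁_invol := S.ρ₁_invol
  ρ₂_invol := S.ρ₀_invol
  ρ_comm f := (S.ρ_comm f).symm
  vtx_surj := S.cell_surj
  edge_surj := S.edge_surj
  cell_surj := S.vtx_surj
  vtx_eq_iff := S.cell_eq_iff
  edge_eq_iff f g := by
    rw [S.edge_eq_iff, S.ρ_comm]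
    tauto
  cell_eq_iff := S.vtx_eq_iff
  vtx_ne := S.cell_ne
  cell_ne := S.vtx_ne
  sgn f := -S.sgn f
  sgn_ρ₀ f := by rw [S.sgn_ρ₂]
  sgn_ρ₁ f := by rw [S.sgn_ρ₁]
  sgn_ρ₂ f := by rw [S.sgn_ρ₀]
  head f := -(S.sgn f * S.head f)
  head_ρ₀ f := by simp [S.sgn_ρ₂, S.head_ρ₂]
  head_ρ₂ f := by simp [S.sgn_ρ₀, S.head_ρ₀]
  pt₀ := S.pt₂
  pt₁ := S.pt₁
  pt₂ := S.pt₀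
  oriented f := by
    have h := S.oriented f
    simp only [cross, Units.val_neg, Int.cast_neg] at h ⊢
    linarith
  glue_ρ₀ f := by simpa [dist_comm] using S.glue_ρ₂ f
  glue_ρ₁ f := by simpa [dist_comm] using S.glue_ρ₁ f
  glue_ρ₂ f := by simpa [dist_comm] using S.glue_ρ₀ f

/-- `+1` if the triangle lies to the left of the directed edge, so that the normal `n` of the edge
(with `t = k × n`) points out of `cell f`; `-1` if `n` points into `cell f`. -/
def side (S : Mesh F V E C) (f : F) : ℤˣ := S.sgn f * S.head f

/-- The closed triangle of a facet. -/
def tri (S : Mesh F V E C) (f : F) : Set Plane := convexHull ℝ {S.pt₀ f, S.pt₁ f, S.pt₂ f}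

/-! ### Incidence matrices -/

open Classical in
/-- `t_{e j}`: is `1` if `e` is incident on `j` and its tangent points towards `j`, `-1` if it
points away from `j`, and `0` otherwise. -/
def D₁ (S : Mesh F V E C) : Matrix E V ℝ := Matrix.of fun e j =>
  if ∃ f, S.edge f = e ∧ S.vtx f = j ∧ S.head f = 1 then 1
  else if ∃ f, S.edge f = e ∧ S.vtx f = j ∧ S.head f = -1 then -1
  else 0

open Classical in
/-- The transpose of `n_{e i}`, which is `1` if the normal at `e` points out of the cell `i`, `-1` if
it points into `i`, and `0` otherwise. -/
def D₂ (S : Mesh F V E C) : Matrix C E ℝ := Matrix.of fun i e =>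
  if ∃ f, S.edge f = e ∧ S.cell f = i ∧ S.side f = 1 then 1
  else if ∃ f, S.edge f = e ∧ S.cell f = i ∧ S.side f = -1 then -1
  else 0

/-- Matrix of the strong gradient on the dual spaces. -/
def D₁bar (S : Mesh F V E C) : Matrix E C ℝ := -(S.D₂)ᵀ

/-- Matrix of the strong curl on the dual spaces. -/
def D₂bar (S : Mesh F V E C) : Matrix V E ℝ := (S.D₁)ᵀ

/-! ### Integrals -/

/-- `∫ p q dA` over the surface. -/
def sInner [Fintype F] (S : Mesh F V E C) (p q : SField F) : ℝ :=
  ∑ f, ∫ x in S.tri f, p f x * q f x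

/-- `∫ u · w dA` over the surface. -/
def vInner [Fintype F] (S : Mesh F V E C) (u w : VField F) : ℝ :=
  ∑ f, ∫ x in S.tri f, inner ℝ (u f x) (w f x)

open Classical in
/-- Integral of a scalar field over the cell `i`. -/
def cellIntegral [Fintype F] (S : Mesh F V E C) (i : C) (q : SField F) : ℝ :=
  ∑ f with S.cell f = i, ∫ x in S.tri f, q f x

open Classical in
/-- Flux `∫ u · n dl` through the edge `e`, which consists of two segments; the field is evaluated
on the two facets to the left of the edge. -/
def edgeFlux [Fintype F] (S : Mesh F V E C) (e : E) (u : VField F) : ℝ :=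
  ∑ f with S.edge f = e ∧ S.side f = 1, ((S.head f : ℤ) : ℝ) *
    lineIntegral (S.pt₁ f) (S.pt₀ f) fun x => inner ℝ (u f x) (unitNormal (S.pt₁ f) (S.pt₀ f))

open Classical in
/-- Circulation `∫ u · t dl` along the edge `e`, evaluated on the two facets to its left. -/
def edgeCirculation [Fintype F] (S : Mesh F V E C) (e : E) (u : VField F) : ℝ :=
  ∑ f with S.edge f = e ∧ S.side f = 1, ((S.head f : ℤ) : ℝ) *
    lineIntegral (S.pt₁ f) (S.pt₀ f) fun x => inner ℝ (u f x) (unitTangent (S.pt₁ f) (S.pt₀ f))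

/-! ### Lowest order spaces on the triangular supermesh -/

/-- Continuity of a scalar field across the sides joining the corners `A f`, `B f`. -/
def ContAcross (ρ : F → F) (A B : F → Plane) (q : SField F) : Prop :=
  ∀ f, ∀ t ∈ Set.Icc (0 : ℝ) 1, q (ρ f) (AffineMap.lineMap (A (ρ f)) (B (ρ f)) t) =
    q f (AffineMap.lineMap (A f) (B f) t)

/-- Continuity of the normal component of a vector field across the sides joining `A f`, `B f`. -/
def NormalContAcross (ρ : F → F) (A B : F → Plane) (u : VField F) : Prop :=
  ∀ f, ∀ t ∈ Set.Icc (0 : ℝ) 1,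
    inner ℝ (u (ρ f) (AffineMap.lineMap (A (ρ f)) (B (ρ f)) t)) (unitNormal (A (ρ f)) (B (ρ f))) =
      inner ℝ (u f (AffineMap.lineMap (A f) (B f) t)) (unitNormal (A f) (B f))

/-- Continuous piecewise linear elements. -/
def P1 (S : Mesh F V E C) : Set (SField F) :=
  {q | (∀ f, ∃ (a : Plane) (b : ℝ), ∀ x, q f x = inner ℝ a x + b) ∧
    ContAcross S.ρ₀ S.pt₁ S.pt₂ q ∧ ContAcross S.ρ₁ S.pt₀ S.pt₂ q ∧ ContAcross S.ρ₂ S.pt₀ S.pt₁ q}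

/-- Lowest order Raviart-Thomas elements. -/
def RT0 (S : Mesh F V E C) : Set (VField F) :=
  {u | (∀ f, ∃ (a : Plane) (b : ℝ), ∀ x, u f x = a + b • x) ∧
    NormalContAcross S.ρ₀ S.pt₁ S.pt₂ u ∧ NormalContAcross S.ρ₁ S.pt₀ S.pt₂ u ∧
    NormalContAcross S.ρ₂ S.pt₀ S.pt₁ u}

/-- Piecewise linear test functions that vanish on all edges of the mesh, that is, on the boundary
of every cell. -/
def P1Zero (S : Mesh F V E C) : Set (SField F) :=
  {η | η ∈ S.P1 ∧ ∀ f, ∀ t ∈ Set.Icc (0 : ℝ) 1, η f (AffineMap.lineMap (S.pt₁ f) (S.pt₀ f) t) = 0}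

/-! ### Compound elements: discrete harmonic extension into the cells -/

/-- The compound P1 space: the tangential derivative is constant along each edge, and the discrete
Laplace equation holds in each cell. -/
def V0 [Fintype F] (S : Mesh F V E C) : Set (SField F) :=
  {q | q ∈ S.P1 ∧
    (∀ e, ∃ c : ℝ, ∀ f, S.edge f = e → ∀ t ∈ Set.Icc (0 : ℝ) 1,
      inner ℝ (grad q f (AffineMap.lineMap (S.pt₁ f) (S.pt₀ f) t))
        (((S.head f : ℤ) : ℝ) • unitTangent (S.pt₁ f) (S.pt₀ f)) = c) ∧
    (∀ i, ∀ η ∈ S.P1Zero, S.cellIntegral i (fun f x => inner ℝ (grad q f x) (grad η f x)) = 0)}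

/-- The compound RT0 space: the normal component is constant along each edge; in each cell the
divergence is constant and the discrete curl vanishes. -/
def V1 [Fintype F] (S : Mesh F V E C) : Set (VField F) :=
  {u | u ∈ S.RT0 ∧
    (∀ e, ∃ c : ℝ, ∀ f, S.edge f = e → ∀ t ∈ Set.Icc (0 : ℝ) 1,
      inner ℝ (u f (AffineMap.lineMap (S.pt₁ f) (S.pt₀ f) t))
        (((S.head f : ℤ) : ℝ) • unitNormal (S.pt₁ f) (S.pt₀ f)) = c) ∧
    (∀ i, ∃ d : ℝ, ∀ f, S.cell f = i → ∀ x, div u f x = d) ∧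
    (∀ i, ∀ η ∈ S.P1Zero, S.cellIntegral i (fun f x => inner ℝ (u f x) (gradPerp η f x)) = 0)}

/-- Piecewise constants on the cells. -/
def V2 (S : Mesh F V E C) : Set (SField F) :=
  {q | ∀ i, ∃ c : ℝ, ∀ f, S.cell f = i → ∀ x, q f x = c}

/-- The dual space `V⁰`: continuous, on the dual mesh. -/
def dualV0 [Fintype F] (S : Mesh F V E C) : Set (SField F) := S.dual.V0

/-- The dual space `V¹`: `k ×` the compound RT0 space of the dual mesh. -/
def dualV1 [Fintype F] (S : Mesh F V E C) : Set (VField F) :=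
  {w | ∃ u ∈ S.dual.V1, ∀ f x, w f x = rot (u f x)}

/-- The dual space `V²`: piecewise constants on the dual cells. -/
def dualV2 (S : Mesh F V E C) : Set (SField F) := S.dual.V2

/-- The normalized basis functions of the three primal and of the three dual spaces. -/
structure Basis [Fintype F] [DecidableEq V] [DecidableEq E] [DecidableEq C]
    (S : Mesh F V E C) where
  α : C → SField F
  v : E → VField F
  γ : V → SField F
  β : V → SField F
  w : E → VField F
  χ : C → SField F
  α_mem : ∀ i, α i ∈ S.V2
  v_mem : ∀ e, v e ∈ S.V1
  γ_mem : ∀ j, γ j ∈ S.V0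
  β_mem : ∀ j, β j ∈ S.dualV2
  w_mem : ∀ e, w e ∈ S.dualV1
  χ_mem : ∀ i, χ i ∈ S.dualV0
  α_norm : ∀ i i', S.cellIntegral i' (α i) = if i = i' then 1 else 0
  v_norm : ∀ e e', S.edgeFlux e' (v e) = if e = e' then 1 else 0
  γ_norm : ∀ j j' f, S.vtx f = j' → γ j f (S.pt₀ f) = if j = j' then 1 else 0
  β_norm : ∀ j j', S.dual.cellIntegral j' (β j) = if j = j' then 1 else 0
  w_norm : ∀ e e', S.dual.edgeCirculation e' (w e) = if e = e' then 1 else 0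
  χ_norm : ∀ i i' f, S.cell f = i' → χ i f (S.pt₂ f) = if i = i' then 1 else 0

namespace Basis

variable [Fintype F] [DecidableEq V] [DecidableEq E] [DecidableEq C] {S : Mesh F V E C}

/-- Mass matrix of `V₂`. -/
def L (B : S.Basis) : Matrix C C ℝ := Matrix.of fun i i' => S.sInner (B.α i) (B.α i')

/-- Mass matrix of `V₁`. -/
def M (B : S.Basis) : Matrix E E ℝ := Matrix.of fun e e' => S.vInner (B.v e) (B.v e')

/-- Mass matrix of `V₀`. -/
def N (B : S.Basis) : Matrix V V ℝ := Matrix.of fun j j' => S.sInner (B.γ j) (B.γ j')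

/-- Discrete Hodge star `V¹ → V₁`. -/
def H (B : S.Basis) : Matrix E E ℝ := Matrix.of fun e e' => S.vInner (B.v e) (B.w e')

/-- Discrete Hodge star `V² → V₀`. -/
def J (B : S.Basis) : Matrix V V ℝ := Matrix.of fun j j' => S.sInner (B.γ j) (B.β j')

/-- Discrete Hodge star `V⁰ → V₂`. -/
def I (B : S.Basis) : Matrix C C ℝ := Matrix.of fun i i' => S.sInner (B.α i) (B.χ i')

end Basis

/-- `g ∈ V₁` is the weak gradient of `φ ∈ V₂`. -/
def IsWeakGrad [Fintype F] (S : Mesh F V E C) (φ : SField F) (g : VField F) : Prop :=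
  g ∈ S.V1 ∧ ∀ u ∈ S.V1, S.vInner u g = -S.sInner (div u) φ

/-- `ξ ∈ V₀` is the weak curl of `u ∈ V₁`. -/
def IsWeakCurl [Fintype F] (S : Mesh F V E C) (u : VField F) (ξ : SField F) : Prop :=
  ξ ∈ S.V0 ∧ ∀ ψ ∈ S.V0, S.sInner ψ ξ = -S.vInner (gradPerp ψ) u

end Mesh

end CompoundFE

end

noncomputable section

namespace CompoundFE

/-! All six spaces consist of lowest order fields on one supermesh, and passing to the dual mesh
only relabels the corners of its triangles. So a continuous dual function may be integrated by parts
against a primal Raviart–Thomas field, and vice versa. The surface is closed and each signed side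
contribution cancels against that of the neighbouring facet (`sum_eq_zero_of_invol`), so
`sInner_div_add_vInner_grad` has no boundary term. Writing both terms in the bases, where divergence
and gradient act by incidence matrices (`div_eq_sum_cellBasis`, `gradPerp_eq_sum_edgeBasis`), gives
the two commutation relations.

The dual mesh is again a `Mesh`, with `D₂bar` and `D₁bar` as its own incidence matrices (`D₂bar_eq`,
`D₁bar_eq`). Everything proved for primal elements therefore holds for dual ones, with `rot`
converting divergence into curl.

The bases exist and are unique by unisolvence. Continuous piecewise linear functions are given by
values at vertices, edge points and centres, Raviart–Thomas fields by side fluxes. The edge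
condition fixes everything on the edges. What is left in a cell is one centre value, or the inner
fluxes up to one multiple of the rotated gradient of the centre hat function, and the discrete
harmonic condition is one linear equation for it with positive coefficient (`moment_self_pos`). For
existence in `V1` the inner fluxes come from a graph Laplace equation on each cycle of facets.

Mass matrices are Gram matrices of a definite form, hence invertible. The weak derivatives follow by
testing with basis elements, and the factorizations are the commutation relations multiplied by
inverses. -/

theorem inner_plane (a b : Plane) : inner ℝ a b = a 0 * b 0 + a 1 * b 1 := by
  simp [PiLp.inner_apply, Fin.sum_univ_two, mul_comm]

theorem plane_ext {a b : Plane} (h₀ : a 0 = b 0) (h₁ : a 1 = b 1) : a = b := by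
  ext i; fin_cases i <;> assumption

@[simp] theorem rot_zero (a : Plane) : rot a 0 = -(a 1) := rfl

@[simp] theorem rot_one (a : Plane) : rot a 1 = a 0 := rfl

/-! ### Integration over triangles -/

/-- The reference triangle. -/
def refTri : Set (ℝ × ℝ) := {z | 0 ≤ z.1 ∧ 0 ≤ z.2 ∧ z.1 + z.2 ≤ 1}

theorem isClosed_refTri : IsClosed refTri :=
  (isClosed_le continuous_const continuous_fst).inter
    ((isClosed_le continuous_const continuous_snd).inter
      (isClosed_le (continuous_fst.add continuous_snd) continuous_const))

theorem isCompact_refTri : IsCompact refTri := by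
  refine IsCompact.of_isClosed_subset (isCompact_Icc (a := ((0 : ℝ), (0 : ℝ))) (b := (1, 1)))
    isClosed_refTri ?_
  rintro ⟨x, y⟩ ⟨h₁, h₂, h₃⟩
  simp only at h₁ h₂ h₃
  exact ⟨⟨h₁, h₂⟩, ⟨by simp only; linarith, by simp only; linarith⟩⟩

/-- Fubini over the strips `0 ≤ y ≤ 1 - x`. The result is the area 1/2 times the value at the
barycentre (1/3, 1/3). -/
theorem setIntegral_refTri (a b c : ℝ) :
    ∫ z in refTri, (a * z.1 + b * z.2 + c) = (a + b + 3 * c) / 6 := by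
  have hint : IntegrableOn (fun z : ℝ × ℝ => a * z.1 + b * z.2 + c) refTri :=
    (by fun_prop : Continuous fun z : ℝ × ℝ => a * z.1 + b * z.2 + c).continuousOn.integrableOn_compact
      isCompact_refTri
  rw [← integral_indicator isClosed_refTri.measurableSet]
  rw [← integrable_indicator_iff isClosed_refTri.measurableSet] at hint
  rw [Measure.volume_eq_prod] at hint ⊢
  rw [integral_prod _ hint]
  have h : ∀ x : ℝ, ∫ y, refTri.indicator (fun z : ℝ × ℝ => a * z.1 + b * z.2 + c) (x, y) =
      (Set.Icc (0 : ℝ) 1).indicator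
        (fun x => (a * x + c) * (1 - x) + b * ((1 - x) ^ 2 / 2)) x := by
    intro x
    by_cases hx : x ∈ Set.Icc (0 : ℝ) 1
    · rw [Set.indicator_of_mem hx]
      have : ∀ y, refTri.indicator (fun z : ℝ × ℝ => a * z.1 + b * z.2 + c) (x, y) =
          (Set.Icc 0 (1 - x)).indicator (fun y => (a * x + c) + b * y) y := by
        intro y
        by_cases hy : y ∈ Set.Icc 0 (1 - x)
        · rw [Set.indicator_of_mem hy, Set.indicator_of_mem]
          · ring
          · exact ⟨hx.1, hy.1, by simp only; linarith [hy.2]⟩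
        · rw [Set.indicator_of_notMem hy, Set.indicator_of_notMem]
          rintro ⟨h₁, h₂, h₃⟩
          simp only at h₁ h₂ h₃
          exact hy ⟨h₂, by linarith⟩
      simp_rw [this]
      rw [integral_indicator measurableSet_Icc, integral_Icc_eq_integral_Ioc,
        ← intervalIntegral.integral_of_le (by linarith [hx.2])]
      rw [intervalIntegral.integral_add (intervalIntegrable_const)
        ((by fun_prop : Continuous fun y : ℝ => b * y).intervalIntegrable _ _),
        intervalIntegral.integral_const_mul]
      simp; ring
    · rw [Set.indicator_of_notMem hx, ← integral_zero ℝ ℝ]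
      congr 1
      funext y
      rw [Set.indicator_of_notMem]
      rintro ⟨h₁, h₂, h₃⟩
      simp only at h₁ h₂ h₃
      exact hx ⟨h₁, by linarith⟩
  simp_rw [h]
  rw [integral_indicator measurableSet_Icc, integral_Icc_eq_integral_Ioc,
    ← intervalIntegral.integral_of_le zero_le_one]
  have hd : ∀ x ∈ Set.uIcc (0 : ℝ) 1, HasDerivAt
      (fun x => a * (x ^ 2 / 2 - x ^ 3 / 3) + c * (x - x ^ 2 / 2) - b * ((1 - x) ^ 3 / 6))
      ((a * x + c) * (1 - x) + b * ((1 - x) ^ 2 / 2)) x := by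
    intro x _
    have h1 := hasDerivAt_id' x
    have h2 := h1.const_sub 1
    have := (((((h1.pow 2).div_const 2).sub ((h1.pow 3).div_const 3)).const_mul a).add
      ((h1.sub ((h1.pow 2).div_const 2)).const_mul c)).sub (((h2.pow 3).div_const 6).const_mul b)
    refine this.congr_deriv ?_
    push_cast
    ring
  rw [intervalIntegral.integral_eq_sub_of_hasDerivAt hd (Continuous.intervalIntegrable
    (by fun_prop) _ _)]
  norm_num
  ring

/-- The affine chart that maps the reference triangle to the triangle with corners `A`, `B`, `C`. -/
def chart (A B C : Plane) (z : ℝ × ℝ) : Plane := B + z.1 • (A - B) + z.2 • (C - B)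

theorem chart_image (A B C : Plane) : chart A B C '' refTri = convexHull ℝ {A, B, C} := by
  apply Set.Subset.antisymm
  · rintro _ ⟨⟨s, t⟩, ⟨h₁, h₂, h₃⟩, rfl⟩
    simp only at h₁ h₂ h₃
    have hA : A ∈ convexHull ℝ {A, B, C} := subset_convexHull ℝ _ (by simp)
    have hB : B ∈ convexHull ℝ {A, B, C} := subset_convexHull ℝ _ (by simp)
    have hC : C ∈ convexHull ℝ {A, B, C} := subset_convexHull ℝ _ (by simp)
    have := (convex_convexHull ℝ {A, B, C}).sum_mem (t := Finset.univ) (w := ![s, 1 - s - t, t])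
      (z := ![A, B, C]) (by intro i _; fin_cases i <;> simp <;> linarith)
      (by simp [Fin.sum_univ_three]; ring) (by intro i _; fin_cases i <;> simpa)
    convert this using 1
    simp only [chart, Fin.sum_univ_three, Matrix.cons_val_zero, Matrix.cons_val_one,
      Matrix.cons_val]
    module
  · apply convexHull_min
    · rintro x (rfl | rfl | rfl)
      · exact ⟨(1, 0), by simp [refTri], by simp [chart]⟩
      · exact ⟨(0, 0), by simp [refTri], by simp [chart]⟩
      · exact ⟨(0, 1), by simp [refTri], by simp [chart]⟩
    · rintro _ ⟨⟨s, t⟩, ⟨h₁, h₂, h₃⟩, rfl⟩ _ ⟨⟨s', t'⟩, ⟨h₁', h₂', h₃'⟩, rfl⟩ p q hp hq hpq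
      simp only at h₁ h₂ h₃ h₁' h₂' h₃'
      refine ⟨(p * s + q * s', p * t + q * t'), ⟨by simp only; positivity, by simp only; positivity,
        ?_⟩, ?_⟩
      · have := mul_le_mul_of_nonneg_left h₃ hp
        have := mul_le_mul_of_nonneg_left h₃' hq
        simp only; nlinarith
      · simp only [chart]
        obtain rfl : p = 1 - q := by linarith
        module

/-- The linear part of a chart, in coordinates. -/
def chartLin (A B C : Plane) : Matrix (Fin 2) (Fin 2) ℝ :=
  !![(A - B) 0, (C - B) 0; (A - B) 1, (C - B) 1]

/-- Change of variables along the affine chart, whose Jacobian is the cross product of two sides.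
The formula is proved on `Fin 2 → ℝ`, which is identified with `Plane` and with `ℝ × ℝ` by volume
preserving maps. -/
theorem setIntegral_tri (A B C : Plane) (hABC : cross (A - B) (C - B) ≠ 0) (g : Plane → ℝ) :
    ∫ x in convexHull ℝ {A, B, C}, g x =
      |cross (A - B) (C - B)| * ∫ z in refTri, g (chart A B C z) := by
  have e₁ := (PiLp.volume_preserving_toLp (Fin 2)).setIntegral_preimage_emb
    (MeasurableEquiv.toLp 2 (Fin 2 → ℝ)).measurableEmbedding g (convexHull ℝ {A, B, C})
  have e₂ := (volume_preserving_finTwoArrow ℝ).setIntegral_preimage_emb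
    MeasurableEquiv.finTwoArrow.measurableEmbedding (fun z => g (chart A B C z)) refTri
  rw [← e₁, ← e₂]
  let ψ : (Fin 2 → ℝ) → (Fin 2 → ℝ) := fun y => WithLp.ofLp B + (chartLin A B C).toLin' y
  have hψ : ∀ y, WithLp.toLp 2 (ψ y) = chart A B C (MeasurableEquiv.finTwoArrow y) := by
    intro y
    have h₀ : (chartLin A B C *ᵥ y) 0 = (A - B) 0 * y 0 + (C - B) 0 * y 1 := by
      simp [chartLin, Matrix.mulVec, dotProduct, Fin.sum_univ_two]
    have h₁ : (chartLin A B C *ᵥ y) 1 = (A - B) 1 * y 0 + (C - B) 1 * y 1 := by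
      simp [chartLin, Matrix.mulVec, dotProduct, Fin.sum_univ_two]
    apply plane_ext
    · simp only [ψ, chart, Matrix.toLin'_apply, Pi.add_apply, h₀]
      simp [MeasurableEquiv.finTwoArrow]; ring
    · simp only [ψ, chart, Matrix.toLin'_apply, Pi.add_apply, h₁]
      simp [MeasurableEquiv.finTwoArrow]; ring
  have hdet : LinearMap.det (chartLin A B C).toLin' = cross (A - B) (C - B) := by
    rw [LinearMap.det_toLin', chartLin, Matrix.det_fin_two_of, cross]
    ring
  have himg : (WithLp.toLp 2 : (Fin 2 → ℝ) → Plane) ⁻¹' (convexHull ℝ {A, B, C}) =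
      ψ '' (MeasurableEquiv.finTwoArrow ⁻¹' refTri) := by
    rw [← chart_image]
    ext y
    constructor
    · rintro ⟨z, hz, hzy⟩
      refine ⟨MeasurableEquiv.finTwoArrow.symm z, by simpa using hz, ?_⟩
      apply WithLp.toLp_injective 2
      rw [hψ, ← hzy]; simp
    · rintro ⟨y', hy', rfl⟩
      exact ⟨_, hy', (hψ y').symm⟩
  rw [himg, integral_image_eq_integral_abs_det_fderiv_smul volume
    (f' := fun _ => LinearMap.toContinuousLinearMap (chartLin A B C).toLin')]
  · simp_rw [ContinuousLinearMap.det, LinearMap.coe_toContinuousLinearMap, hdet, hψ, smul_eq_mul]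
    rw [integral_const_mul]
  · exact (MeasurableEquiv.finTwoArrow.measurable) isClosed_refTri.measurableSet
  · intro x _
    exact ((LinearMap.toContinuousLinearMap (chartLin A B C).toLin').hasFDerivAt.const_add
      _).hasFDerivWithinAt
  · intro x _ y _ hxy
    have hker : LinearMap.ker (chartLin A B C).toLin' = ⊥ := by
      rw [← LinearMap.isUnit_iff_ker_eq_bot, LinearMap.isUnit_iff_isUnit_det, hdet]
      exact isUnit_iff_ne_zero.mpr hABC
    exact LinearMap.ker_eq_bot.mp hker (add_left_cancel hxy)

theorem setIntegral_tri_affine (A B C : Plane) (hABC : cross (A - B) (C - B) ≠ 0) (a : Plane)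
    (b : ℝ) :
    ∫ x in convexHull ℝ {A, B, C}, (inner ℝ a x + b) = |cross (A - B) (C - B)| / 2 *
      ((inner ℝ a A + inner ℝ a B + inner ℝ a C) / 3 + b) := by
  rw [setIntegral_tri A B C hABC]
  have : ∀ z : ℝ × ℝ, inner ℝ a (chart A B C z) + b =
      inner ℝ a (A - B) * z.1 + inner ℝ a (C - B) * z.2 + (inner ℝ a B + b) := by
    intro z
    simp only [chart, inner_add_right, inner_smul_right]
    ring
  simp_rw [this]
  rw [setIntegral_refTri]
  simp only [inner_sub_right]
  ring

theorem isCompact_tri (A B C : Plane) : IsCompact (convexHull ℝ {A, B, C}) :=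
  (Set.toFinite _).isCompact_convexHull ℝ

/-- A convex set with nonempty interior lies in the closure of that interior. This upgrades almost
everywhere equality of continuous functions to equality on the closed triangle. -/
theorem refTri_subset_closure_interior : refTri ⊆ closure (interior refTri) := by
  have hconv : Convex ℝ refTri := by
    rintro ⟨s, t⟩ ⟨h₁, h₂, h₃⟩ ⟨s', t'⟩ ⟨h₁', h₂', h₃'⟩ p q hp hq hpq
    simp only at h₁ h₂ h₃ h₁' h₂' h₃'
    refine ⟨?_, ?_, ?_⟩
    · simp; positivity
    · simp; positivity
    · have := mul_le_mul_of_nonneg_left h₃ hp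
      have := mul_le_mul_of_nonneg_left h₃' hq
      simp; nlinarith
  have hne : (interior refTri).Nonempty := by
    refine ⟨(1 / 4, 1 / 4), mem_interior.mpr ⟨{z | 0 < z.1 ∧ 0 < z.2 ∧ z.1 + z.2 < 1}, ?_, ?_, ?_⟩⟩
    · rintro z ⟨h₁, h₂, h₃⟩
      exact ⟨h₁.le, h₂.le, h₃.le⟩
    · exact (isOpen_lt continuous_const continuous_fst).inter
        ((isOpen_lt continuous_const continuous_snd).inter
          (isOpen_lt (continuous_fst.add continuous_snd) continuous_const))
    · norm_num
  rw [hconv.closure_interior_eq_closure_of_nonempty_interior hne]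
  exact subset_closure

/-- The conclusion includes the boundary of the triangle, so it can be used at the corners, where
degrees of freedom are read off. -/
theorem eq_zero_of_setIntegral_tri {A B C : Plane} (hABC : cross (A - B) (C - B) ≠ 0)
    {g : Plane → ℝ} (hg : Continuous g) (h₀ : ∀ z, 0 ≤ g z)
    (h : ∫ x in convexHull ℝ {A, B, C}, g x = 0) : ∀ x ∈ convexHull ℝ {A, B, C}, g x = 0 := by
  have hchart : Continuous (chart A B C) := by unfold chart; fun_prop
  rw [setIntegral_tri A B C hABC, mul_eq_zero, or_iff_right (abs_ne_zero.mpr hABC)] at h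
  rw [integral_eq_zero_iff_of_nonneg (fun _ => h₀ _)
    ((hg.comp hchart).continuousOn.integrableOn_compact isCompact_refTri)] at h
  have := Measure.eqOn_of_ae_eq h (hg.comp hchart).continuousOn continuousOn_const
    refTri_subset_closure_interior
  rw [← chart_image]
  rintro _ ⟨z, hz, rfl⟩
  exact this hz

/-! ### Derivatives and side traces of affine fields -/

theorem gradient_affine {q : Plane → ℝ} {a : Plane} {b : ℝ} (hq : ∀ x, q x = inner ℝ a x + b)
    (x : Plane) : gradient q x = a := by
  apply HasGradientAt.gradient
  rw [show q = fun x => inner ℝ a x + b from funext hq, hasGradientAt_iff_hasFDerivAt]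
  exact ((InnerProductSpace.toDual ℝ Plane a).hasFDerivAt).add_const b

theorem fderiv_affine {u : Plane → Plane} {a : Plane} {b : ℝ} (hu : ∀ x, u x = a + b • x)
    (x y : Plane) : fderiv ℝ u x y = b • y := by
  have : HasFDerivAt u (b • ContinuousLinearMap.id ℝ Plane) x := by
    rw [show u = fun x => a + b • x from funext hu]
    exact ((b • ContinuousLinearMap.id ℝ Plane).hasFDerivAt).const_add a
  rw [this.fderiv]
  rfl

theorem pdiv_affine {u : Plane → Plane} {a : Plane} {b : ℝ} (hu : ∀ x, u x = a + b • x)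
    (x : Plane) : pdiv u x = 2 * b := by
  simp only [pdiv, fderiv_affine hu]
  simp; ring

theorem rot_add (a b : Plane) : rot (a + b) = rot a + rot b :=
  plane_ext (by simp; ring) (by simp)

theorem rot_smul (c : ℝ) (a : Plane) : rot (c • a) = c • rot a :=
  plane_ext (by simp) (by simp)

theorem rot_rot (a : Plane) : rot (rot a) = -a :=
  plane_ext (by simp) (by simp)

/-- Rotation by a right angle as a continuous linear map. -/
def rotL : Plane →L[ℝ] Plane :=
  LinearMap.toContinuousLinearMap { toFun := rot, map_add' := rot_add, map_smul' := rot_smul }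

theorem rotL_apply (a : Plane) : rotL a = rot a := rfl

theorem pcurl_rot_affine {u : Plane → Plane} {a : Plane} {b : ℝ} (hu : ∀ x, u x = a + b • x)
    (x : Plane) : pcurl (fun x => rot (u x)) x = 2 * b := by
  have h : HasFDerivAt (fun x => rot (u x)) (b • rotL) x := by
    rw [show (fun x => rot (u x)) = fun x => rot a + (b • rotL) x from
      funext fun x => by rw [hu, rot_add, rot_smul]; rfl]
    exact (b • rotL).hasFDerivAt.const_add _
  simp only [pcurl, h.fderiv, _root_.smul_apply, rotL_apply]
  simp; ring

theorem inner_rot_rot (a b : Plane) : inner ℝ (rot a) (rot b) = inner ℝ a b := by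
  simp only [inner_plane, rot_zero, rot_one]; ring

theorem inner_rot_left (a b : Plane) : inner ℝ (rot a) b = -inner ℝ a (rot b) := by
  simp only [inner_plane, rot_zero, rot_one]; ring

theorem inner_neg_rot (a b : Plane) : inner ℝ a (-rot b) = cross a b := by
  simp [inner_plane, cross]; ring

theorem inner_unitTangent (a A B : Plane) :
    inner ℝ a (unitTangent A B) = (dist A B)⁻¹ * inner ℝ a (B - A) := by
  rw [unitTangent, inner_smul_right]

theorem inner_unitNormal (a A B : Plane) :
    inner ℝ a (unitNormal A B) = (dist A B)⁻¹ * cross a (B - A) := by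
  rw [unitNormal, inner_neg_rot, unitTangent]
  simp [cross]; ring

/-- Reduces continuity across a side to agreement at its two end points. -/
theorem affine_lineMap {q : Plane → ℝ} {a : Plane} {b : ℝ} (hq : ∀ x, q x = inner ℝ a x + b)
    (A B : Plane) (t : ℝ) : q (AffineMap.lineMap A B t) = (1 - t) * q A + t * q B := by
  simp only [hq, AffineMap.lineMap_apply_module, inner_add_right, inner_smul_right]
  ring

/-- The normal component of a lowest order Raviart-Thomas field is constant along a line. -/
theorem cross_lineMap {u : Plane → Plane} {a : Plane} {b : ℝ} (hu : ∀ x, u x = a + b • x)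
    (A B : Plane) (t : ℝ) :
    cross (u (AffineMap.lineMap A B t)) (B - A) = cross (u A) (B - A) := by
  simp only [hu, AffineMap.lineMap_apply_module, cross]
  simp; ring

/-! ### Signs, sizes and incidences of facets -/

namespace Mesh

variable {F V E C : Type*} (S : Mesh F V E C)

/-- Sign of the orientation of the drawn facet, as a real number. -/
def sg (f : F) : ℝ := ((S.sgn f : ℤ) : ℝ)

/-- Direction of the edge at the facet, as a real number. -/
def hd (f : F) : ℝ := ((S.head f : ℤ) : ℝ)

/-- Twice the signed area of the drawn facet. -/
def jac (f : F) : ℝ := cross (S.pt₀ f - S.pt₁ f) (S.pt₂ f - S.pt₁ f)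

/-- Area of a facet. -/
def area (f : F) : ℝ := S.sg f * S.jac f / 2

/-- Length of the half edge at a facet. -/
def len (f : F) : ℝ := dist (S.pt₁ f) (S.pt₀ f)

theorem sg_mul_self (f : F) : S.sg f * S.sg f = 1 := by
  rcases Int.units_eq_one_or (S.sgn f) with h | h <;> simp [sg, h]

theorem hd_mul_self (f : F) : S.hd f * S.hd f = 1 := by
  rcases Int.units_eq_one_or (S.head f) with h | h <;> simp [hd, h]

theorem sg_ρ₀ (f : F) : S.sg (S.ρ₀ f) = -S.sg f := by simp [sg, S.sgn_ρ₀]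

theorem sg_ρ₁ (f : F) : S.sg (S.ρ₁ f) = -S.sg f := by simp [sg, S.sgn_ρ₁]

theorem sg_ρ₂ (f : F) : S.sg (S.ρ₂ f) = -S.sg f := by simp [sg, S.sgn_ρ₂]

theorem hd_ρ₀ (f : F) : S.hd (S.ρ₀ f) = -S.hd f := by simp [hd, S.head_ρ₀]

theorem hd_ρ₂ (f : F) : S.hd (S.ρ₂ f) = S.hd f := by simp [hd, S.head_ρ₂]

theorem area_pos (f : F) : 0 < S.area f := half_pos (S.oriented f)

theorem jac_ne_zero (f : F) : S.jac f ≠ 0 := fun h => by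
  have := S.area_pos f
  simp [area, h] at this

theorem jac_eq (f : F) : S.jac f = 2 * S.sg f * S.area f := by
  have := S.sg_mul_self f
  simp only [area]
  linear_combination (-S.jac f) * this

theorem abs_jac (f : F) : |S.jac f| = 2 * S.area f := by
  have h := S.area_pos f
  rw [S.jac_eq, abs_mul, abs_mul, abs_of_pos h]
  rcases Int.units_eq_one_or (S.sgn f) with h | h <;> simp [sg, h]

theorem len_pos (f : F) : 0 < S.len f := by
  refine dist_pos.mpr fun h => S.jac_ne_zero f ?_
  simp [jac, h, cross]

theorem len_ρ₂ (f : F) : S.len (S.ρ₂ f) = S.len f := by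
  simpa [len, dist_comm] using S.glue_ρ₂ f

theorem vtx_ρ₁ (f : F) : S.vtx (S.ρ₁ f) = S.vtx f :=
  ((S.vtx_eq_iff _ _).mpr (.single (Or.inl rfl))).symm

theorem vtx_ρ₂ (f : F) : S.vtx (S.ρ₂ f) = S.vtx f :=
  ((S.vtx_eq_iff _ _).mpr (.single (Or.inr rfl))).symm

theorem cell_ρ₁ (f : F) : S.cell (S.ρ₁ f) = S.cell f :=
  ((S.cell_eq_iff _ _).mpr (.single (Or.inl rfl))).symm

theorem cell_ρ₀ (f : F) : S.cell (S.ρ₀ f) = S.cell f :=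
  ((S.cell_eq_iff _ _).mpr (.single (Or.inr rfl))).symm

theorem edge_ρ₀ (f : F) : S.edge (S.ρ₀ f) = S.edge f :=
  ((S.edge_eq_iff _ _).mpr (by simp)).symm

theorem edge_ρ₂ (f : F) : S.edge (S.ρ₂ f) = S.edge f :=
  ((S.edge_eq_iff _ _).mpr (by simp)).symm

/-- A function on the facets that is constant around every vertex is a function of the vertex. -/
theorem exists_vtx_function {h : F → ℝ} (h₁ : ∀ f, h (S.ρ₁ f) = h f)
    (h₂ : ∀ f, h (S.ρ₂ f) = h f) : ∃ k : V → ℝ, h = k ∘ S.vtx := by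
  refine ⟨fun j => h (Function.surjInv S.vtx_surj j), funext fun f => ?_⟩
  have := (S.vtx_eq_iff f _).mp (Function.surjInv_eq S.vtx_surj (S.vtx f)).symm
  simp only [Function.comp]
  generalize Function.surjInv S.vtx_surj (S.vtx f) = g at this
  induction this with
  | refl => rfl
  | tail _ hbc ih => rcases hbc with rfl | rfl <;> simp [ih, h₁, h₂]

/-- This is the vertex statement on the dual mesh, where cells are vertices and `ρ₀` plays the role
of `ρ₂`. -/
theorem exists_cell_function {h : F → ℝ} (h₁ : ∀ f, h (S.ρ₁ f) = h f)
    (h₀ : ∀ f, h (S.ρ₀ f) = h f) : ∃ k : C → ℝ, h = k ∘ S.cell :=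
  S.dual.exists_vtx_function h₁ h₀

theorem exists_edge_function {h : F → ℝ} (h₀ : ∀ f, h (S.ρ₀ f) = h f)
    (h₂ : ∀ f, h (S.ρ₂ f) = h f) : ∃ k : E → ℝ, h = k ∘ S.edge := by
  refine ⟨fun j => h (Function.surjInv S.edge_surj j), funext fun f => ?_⟩
  have := (S.edge_eq_iff f _).mp (Function.surjInv_eq S.edge_surj (S.edge f)).symm
  simp only [Function.comp]
  rcases this with h | h | h | h <;> simp [h, h₀, h₂]

/-! ### Piecewise linear functions in terms of their nodal values -/

/-- Gradient of the linear function with corner values `h₀ f`, `h₁ f`, `h₂ f`. -/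
def lagGrad (h₀ h₁ h₂ : F → ℝ) (f : F) : Plane :=
  (S.jac f)⁻¹ • rot (h₀ f • (S.pt₁ f - S.pt₂ f) + h₁ f • (S.pt₂ f - S.pt₀ f) +
    h₂ f • (S.pt₀ f - S.pt₁ f))

/-- The piecewise linear function with corner values `h₀ f`, `h₁ f`, `h₂ f`. -/
def lagrange (h₀ h₁ h₂ : F → ℝ) : SField F := fun f x =>
  inner ℝ (S.lagGrad h₀ h₁ h₂ f) x + (h₁ f - inner ℝ (S.lagGrad h₀ h₁ h₂ f) (S.pt₁ f))

theorem lagrange_pt₁ (h₀ h₁ h₂ : F → ℝ) (f : F) : S.lagrange h₀ h₁ h₂ f (S.pt₁ f) = h₁ f := by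
  simp [lagrange]

theorem lagrange_pt₀ (h₀ h₁ h₂ : F → ℝ) (f : F) : S.lagrange h₀ h₁ h₂ f (S.pt₀ f) = h₀ f := by
  have h := S.jac_ne_zero f
  simp only [lagrange, lagGrad, inner_smul_left, inner_plane]
  simp only [conj_trivial, rot_zero, rot_one, PiLp.add_apply, PiLp.smul_apply, PiLp.sub_apply,
    smul_eq_mul]
  field_simp
  simp only [jac, cross, PiLp.sub_apply]
  ring

theorem lagrange_pt₂ (h₀ h₁ h₂ : F → ℝ) (f : F) : S.lagrange h₀ h₁ h₂ f (S.pt₂ f) = h₂ f := by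
  have h := S.jac_ne_zero f
  simp only [lagrange, lagGrad, inner_smul_left, inner_plane]
  simp only [conj_trivial, rot_zero, rot_one, PiLp.add_apply, PiLp.smul_apply, PiLp.sub_apply,
    smul_eq_mul]
  field_simp
  simp only [jac, cross, PiLp.sub_apply]
  ring

theorem grad_lagrange (h₀ h₁ h₂ : F → ℝ) (f : F) (x : Plane) :
    grad (S.lagrange h₀ h₁ h₂) f x = S.lagGrad h₀ h₁ h₂ f :=
  gradient_affine (fun _ => rfl) x

theorem eq_lagrange {q : SField F} (hq : ∀ f, ∃ (a : Plane) (b : ℝ), ∀ x, q f x = inner ℝ a x + b) :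
    q = S.lagrange (fun f => q f (S.pt₀ f)) (fun f => q f (S.pt₁ f)) (fun f => q f (S.pt₂ f)) := by
  funext f x
  obtain ⟨a, b, h⟩ := hq f
  have ha : S.lagGrad (fun f => q f (S.pt₀ f)) (fun f => q f (S.pt₁ f))
      (fun f => q f (S.pt₂ f)) f = a := by
    have hj := S.jac_ne_zero f
    rw [lagGrad, inv_smul_eq_iff₀ hj]
    apply plane_ext <;>
    · simp only [h, inner_plane, rot_zero, rot_one, PiLp.add_apply, PiLp.smul_apply,
        PiLp.sub_apply, smul_eq_mul, jac, cross]
      ring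
  simp only [lagrange, ha, h]
  ring

/-- Each corner is preserved by the two reflections across the sides through it, so continuity makes
the corner values constant on the facets around a vertex, an edge point or a centre. Conversely,
values that agree at both ends of a side agree along it. -/
theorem mem_P1_iff (q : SField F) : q ∈ S.P1 ↔ ∃ (k₀ : V → ℝ) (k₁ : E → ℝ) (k₂ : C → ℝ),
    q = S.lagrange (k₀ ∘ S.vtx) (k₁ ∘ S.edge) (k₂ ∘ S.cell) := by
  constructor
  · rintro ⟨hq, c₀, c₁, c₂⟩
    have z : (0 : ℝ) ∈ Set.Icc (0 : ℝ) 1 := by simp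
    have o : (1 : ℝ) ∈ Set.Icc (0 : ℝ) 1 := by simp
    obtain ⟨k₀, h₀⟩ := S.exists_vtx_function (h := fun f => q f (S.pt₀ f))
      (fun f => by simpa using c₁ f 0 z) (fun f => by simpa using c₂ f 0 z)
    obtain ⟨k₁, h₁⟩ := S.exists_edge_function (h := fun f => q f (S.pt₁ f))
      (fun f => by simpa using c₀ f 0 z) (fun f => by simpa using c₂ f 1 o)
    obtain ⟨k₂, h₂⟩ := S.exists_cell_function (h := fun f => q f (S.pt₂ f))
      (fun f => by simpa using c₁ f 1 o) (fun f => by simpa using c₀ f 1 o)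
    exact ⟨k₀, k₁, k₂, by rw [← h₀, ← h₁, ← h₂]; exact S.eq_lagrange hq⟩
  · rintro ⟨k₀, k₁, k₂, rfl⟩
    refine ⟨fun f => ⟨_, _, fun x => rfl⟩, fun f t _ => ?_, fun f t _ => ?_, fun f t _ => ?_⟩ <;>
    · rw [affine_lineMap (q := S.lagrange _ _ _ _) (fun _ => rfl),
        affine_lineMap (q := S.lagrange _ _ _ f) (fun _ => rfl)]
      simp only [lagrange_pt₀, lagrange_pt₁, lagrange_pt₂, Function.comp, vtx_ρ₁, vtx_ρ₂, edge_ρ₀,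
        edge_ρ₂, cell_ρ₀, cell_ρ₁]

/-! ### Raviart-Thomas fields in terms of their fluxes -/

/-- Signed flux through the side opposite to the primal vertex. -/
def flux₀ (u : VField F) (f : F) : ℝ := cross (u f (S.pt₁ f)) (S.pt₂ f - S.pt₁ f)

/-- Signed flux through the side opposite to the edge point. -/
def flux₁ (u : VField F) (f : F) : ℝ := cross (u f (S.pt₂ f)) (S.pt₀ f - S.pt₂ f)

/-- Signed flux through the side opposite to the cell centre. -/
def flux₂ (u : VField F) (f : F) : ℝ := cross (u f (S.pt₀ f)) (S.pt₁ f - S.pt₀ f)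

/-- The piecewise Raviart-Thomas field with given fluxes. -/
def rt (s₀ s₁ s₂ : F → ℝ) : VField F := fun f x =>
  (S.jac f)⁻¹ • (s₀ f • S.pt₀ f + s₁ f • S.pt₁ f + s₂ f • S.pt₂ f) +
    (-(s₀ f + s₁ f + s₂ f) / S.jac f) • x

/-- The field `rt` equals `-jac⁻¹ ∑ sₖ (x - ptₖ)`. Its term for `k` is parallel to both sides
through `ptₖ`, hence has flux only through the opposite side. -/
theorem flux₀_rt (s₀ s₁ s₂ : F → ℝ) (f : F) : S.flux₀ (S.rt s₀ s₁ s₂) f = s₀ f := by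
  have h := S.jac_ne_zero f
  simp only [flux₀, rt, cross, PiLp.add_apply, PiLp.smul_apply, PiLp.sub_apply, smul_eq_mul]
  field_simp
  simp only [jac, cross, PiLp.sub_apply]
  ring

theorem flux₁_rt (s₀ s₁ s₂ : F → ℝ) (f : F) : S.flux₁ (S.rt s₀ s₁ s₂) f = s₁ f := by
  have h := S.jac_ne_zero f
  simp only [flux₁, rt, cross, PiLp.add_apply, PiLp.smul_apply, PiLp.sub_apply, smul_eq_mul]
  field_simp
  simp only [jac, cross, PiLp.sub_apply]
  ring

theorem flux₂_rt (s₀ s₁ s₂ : F → ℝ) (f : F) : S.flux₂ (S.rt s₀ s₁ s₂) f = s₂ f := by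
  have h := S.jac_ne_zero f
  simp only [flux₂, rt, cross, PiLp.add_apply, PiLp.smul_apply, PiLp.sub_apply, smul_eq_mul]
  field_simp
  simp only [jac, cross, PiLp.sub_apply]
  ring

theorem eq_rt {u : VField F} (hu : ∀ f, ∃ (a : Plane) (b : ℝ), ∀ x, u f x = a + b • x) :
    u = S.rt (S.flux₀ u) (S.flux₁ u) (S.flux₂ u) := by
  funext f x
  obtain ⟨a, b, h⟩ := hu f
  have hj := S.jac_ne_zero f
  apply plane_ext <;>
  · simp only [rt, h, PiLp.add_apply, PiLp.smul_apply, smul_eq_mul]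
    field_simp
    simp only [h, PiLp.add_apply, PiLp.smul_apply, PiLp.sub_apply, smul_eq_mul, jac, cross, flux₀,
      flux₁, flux₂]
    ring

theorem div_rt (s₀ s₁ s₂ : F → ℝ) (f : F) (x : Plane) :
    div (S.rt s₀ s₁ s₂) f x = 2 * (-(s₀ f + s₁ f + s₂ f) / S.jac f) :=
  pdiv_affine (fun _ => rfl) x

theorem normal_pt₀_pt₁ {u : VField F} (hu : ∀ f, ∃ (a : Plane) (b : ℝ), ∀ x, u f x = a + b • x)
    (f : F) (t : ℝ) : inner ℝ (u f (AffineMap.lineMap (S.pt₀ f) (S.pt₁ f) t))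
      (unitNormal (S.pt₀ f) (S.pt₁ f)) = (dist (S.pt₀ f) (S.pt₁ f))⁻¹ * S.flux₂ u f := by
  obtain ⟨a, b, h⟩ := hu f
  rw [inner_unitNormal, cross_lineMap h, flux₂]

theorem normal_pt₁_pt₂ {u : VField F} (hu : ∀ f, ∃ (a : Plane) (b : ℝ), ∀ x, u f x = a + b • x)
    (f : F) (t : ℝ) : inner ℝ (u f (AffineMap.lineMap (S.pt₁ f) (S.pt₂ f) t))
      (unitNormal (S.pt₁ f) (S.pt₂ f)) = (dist (S.pt₁ f) (S.pt₂ f))⁻¹ * S.flux₀ u f := by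
  obtain ⟨a, b, h⟩ := hu f
  rw [inner_unitNormal, cross_lineMap h, flux₀]

/-- The minus sign appears because `flux₁` traverses the side from `pt₂` to `pt₀`. -/
theorem normal_pt₀_pt₂ {u : VField F} (hu : ∀ f, ∃ (a : Plane) (b : ℝ), ∀ x, u f x = a + b • x)
    (f : F) (t : ℝ) : inner ℝ (u f (AffineMap.lineMap (S.pt₀ f) (S.pt₂ f) t))
      (unitNormal (S.pt₀ f) (S.pt₂ f)) = -((dist (S.pt₀ f) (S.pt₂ f))⁻¹ * S.flux₁ u f) := by
  obtain ⟨a, b, h⟩ := hu f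
  rw [inner_unitNormal, cross_lineMap h, flux₁, ← mul_neg]
  congr 1
  simp only [h, cross, PiLp.add_apply, PiLp.smul_apply, PiLp.sub_apply, smul_eq_mul]
  ring

theorem normal_pt₁_pt₀ {u : VField F} (hu : ∀ f, ∃ (a : Plane) (b : ℝ), ∀ x, u f x = a + b • x)
    (f : F) (t : ℝ) : inner ℝ (u f (AffineMap.lineMap (S.pt₁ f) (S.pt₀ f) t))
      (unitNormal (S.pt₁ f) (S.pt₀ f)) = -((S.len f)⁻¹ * S.flux₂ u f) := by
  obtain ⟨a, b, h⟩ := hu f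
  rw [inner_unitNormal, cross_lineMap h, flux₂, ← mul_neg, len]
  congr 1
  simp only [h, cross, PiLp.add_apply, PiLp.smul_apply, PiLp.sub_apply, smul_eq_mul]
  ring

theorem dist_pt₁_pt₂_pos (f : F) : 0 < dist (S.pt₁ f) (S.pt₂ f) := by
  refine dist_pos.mpr fun h => S.jac_ne_zero f ?_
  simp [jac, h, cross]

theorem dist_pt₀_pt₂_pos (f : F) : 0 < dist (S.pt₀ f) (S.pt₂ f) := by
  refine dist_pos.mpr fun h => S.jac_ne_zero f ?_
  simp [jac, h, cross]; ring

theorem dist_pt₀_pt₁_pos (f : F) : 0 < dist (S.pt₀ f) (S.pt₁ f) := by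
  rw [dist_comm]; exact S.len_pos f

/-- The normal component is constant along a side and glued sides have equal length, so normal
continuity is equality of one number per side. No sign enters, since both facets traverse the side
between the same labelled corners. -/
theorem mem_RT0_iff (u : VField F) : u ∈ S.RT0 ↔
    (∀ f, ∃ (a : Plane) (b : ℝ), ∀ x, u f x = a + b • x) ∧
      (∀ f, S.flux₀ u (S.ρ₀ f) = S.flux₀ u f) ∧ (∀ f, S.flux₁ u (S.ρ₁ f) = S.flux₁ u f) ∧
        ∀ f, S.flux₂ u (S.ρ₂ f) = S.flux₂ u f := by
  have z : (0 : ℝ) ∈ Set.Icc (0 : ℝ) 1 := by simp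
  refine and_congr_right fun hu => ?_
  refine and_congr ?_ (and_congr ?_ ?_) <;> refine forall_congr' fun f => ?_
  · simp only [S.normal_pt₁_pt₂ hu, S.glue_ρ₀, mul_eq_mul_left_iff, inv_eq_zero,
      (S.dist_pt₁_pt₂_pos f).ne', or_false]
    exact ⟨fun h => h 0 z, fun h _ _ => h⟩
  · simp only [S.normal_pt₀_pt₂ hu, S.glue_ρ₁, mul_eq_mul_left_iff, inv_eq_zero, neg_inj,
      (S.dist_pt₀_pt₂_pos f).ne', or_false]
    exact ⟨fun h => h 0 z, fun h _ _ => h⟩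
  · simp only [S.normal_pt₀_pt₁ hu, S.glue_ρ₂, mul_eq_mul_left_iff, inv_eq_zero,
      (S.dist_pt₀_pt₁_pos f).ne', or_false]
    exact ⟨fun h => h 0 z, fun h _ _ => h⟩

end Mesh

/-! ### Algebra of facetwise affine fields -/

/-- The scalar field is affine on every facet. -/
def AffineScalar {F : Type*} (q : SField F) : Prop :=
  ∀ f, ∃ (a : Plane) (b : ℝ), ∀ x, q f x = inner ℝ a x + b

/-- The vector field is a lowest order Raviart-Thomas field on every facet. -/
def AffineVector {F : Type*} (u : VField F) : Prop :=
  ∀ f, ∃ (a : Plane) (b : ℝ), ∀ x, u f x = a + b • x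

namespace AffineScalar

variable {F : Type*} {p q : SField F}

theorem add (hp : AffineScalar p) (hq : AffineScalar q) : AffineScalar (p + q) := fun f => by
  obtain ⟨a, b, h⟩ := hp f
  obtain ⟨a', b', h'⟩ := hq f
  exact ⟨a + a', b + b', fun x => by simp only [Pi.add_apply, h, h', inner_add_left]; ring⟩

theorem smul (c : ℝ) (hp : AffineScalar p) : AffineScalar (c • p) := fun f => by
  obtain ⟨a, b, h⟩ := hp f
  exact ⟨c • a, c * b, fun x => by
    simp only [Pi.smul_apply, h, inner_smul_left, smul_eq_mul, conj_trivial]; ring⟩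

theorem grad_eq (hp : AffineScalar p) (f : F) (x y : Plane) : grad p f x = grad p f y := by
  obtain ⟨a, b, h⟩ := hp f
  rw [grad, gradient_affine h, gradient_affine h]

theorem grad_add (hp : AffineScalar p) (hq : AffineScalar q) :
    grad (p + q) = grad p + grad q := by
  funext f x
  obtain ⟨a, b, h⟩ := hp f
  obtain ⟨a', b', h'⟩ := hq f
  rw [Pi.add_apply, Pi.add_apply, grad, grad, grad, gradient_affine h, gradient_affine h',
    gradient_affine (a := a + a') (b := b + b') fun x => by
      simp only [Pi.add_apply, h, h', inner_add_left]; ring]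

theorem grad_smul (c : ℝ) (hp : AffineScalar p) : grad (c • p) = c • grad p := by
  funext f x
  obtain ⟨a, b, h⟩ := hp f
  rw [Pi.smul_apply, Pi.smul_apply, grad, grad, gradient_affine h,
    gradient_affine (a := c • a) (b := c * b) fun x => by
      simp only [Pi.smul_apply, h, inner_smul_left, smul_eq_mul, conj_trivial]; ring]

theorem continuous (hp : AffineScalar p) (f : F) : Continuous (p f) := by
  obtain ⟨a, b, h⟩ := hp f
  rw [show p f = fun x => inner ℝ a x + b from funext h]
  fun_prop

end AffineScalar

namespace AffineVector

variable {F : Type*} {u v : VField F}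

theorem add (hu : AffineVector u) (hv : AffineVector v) : AffineVector (u + v) := fun f => by
  obtain ⟨a, b, h⟩ := hu f
  obtain ⟨a', b', h'⟩ := hv f
  exact ⟨a + a', b + b', fun x => by simp only [Pi.add_apply, h, h']; module⟩

theorem smul (c : ℝ) (hu : AffineVector u) : AffineVector (c • u) := fun f => by
  obtain ⟨a, b, h⟩ := hu f
  exact ⟨c • a, c * b, fun x => by simp only [Pi.smul_apply, h]; module⟩

theorem continuous (hu : AffineVector u) (f : F) : Continuous (u f) := by
  obtain ⟨a, b, h⟩ := hu f
  rw [show u f = fun x => a + b • x from funext h]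
  fun_prop

theorem div_add (hu : AffineVector u) (hv : AffineVector v) : div (u + v) = div u + div v := by
  funext f x
  obtain ⟨a, b, h⟩ := hu f
  obtain ⟨a', b', h'⟩ := hv f
  rw [Pi.add_apply, Pi.add_apply, div, div, div, pdiv_affine h, pdiv_affine h',
    pdiv_affine (a := a + a') (b := b + b') fun x => by simp only [Pi.add_apply, h, h']; module]
  ring

theorem div_smul (c : ℝ) (hu : AffineVector u) : div (c • u) = c • div u := by
  funext f x
  obtain ⟨a, b, h⟩ := hu f
  rw [Pi.smul_apply, Pi.smul_apply, div, div, pdiv_affine h,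
    pdiv_affine (a := c • a) (b := c * b) fun x => by simp only [Pi.smul_apply, h]; module]
  simp only [smul_eq_mul]; ring

theorem div_eq (hu : AffineVector u) (f : F) (x y : Plane) : div u f x = div u f y := by
  obtain ⟨a, b, h⟩ := hu f
  rw [div, pdiv_affine h, pdiv_affine h]

/-- Turns the strong curl on the dual spaces into the divergence on the dual mesh. -/
theorem curl_rot (hu : AffineVector u) : curl (fun f x => rot (u f x)) = div u := by
  funext f x
  obtain ⟨a, b, h⟩ := hu f
  rw [curl, div, pdiv_affine h, pcurl_rot_affine h]

end AffineVector

/-! ### Integration by parts -/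

namespace Mesh

variable {F V E C : Type*} (S : Mesh F V E C)

theorem integrableOn_tri {g : Plane → ℝ} (hg : Continuous g) (f : F) :
    IntegrableOn g (S.tri f) :=
  hg.continuousOn.integrableOn_compact (isCompact_tri _ _ _)

theorem pt₀_mem_tri (f : F) : S.pt₀ f ∈ S.tri f := subset_convexHull ℝ _ (by simp)

/-- Barycentre of a facet. -/
def cen (f : F) : Plane := (1 / 3 : ℝ) • (S.pt₀ f + S.pt₁ f + S.pt₂ f)

/-- One-point quadrature: the mean of the corner values of an affine function is its value at the
barycentre. -/
theorem setIntegral_tri_affine (f : F) {g : Plane → ℝ} {a : Plane} {b : ℝ}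
    (hg : ∀ x, g x = inner ℝ a x + b) : ∫ x in S.tri f, g x = S.area f * g (S.cen f) := by
  simp only [hg]
  have h := CompoundFE.setIntegral_tri_affine (S.pt₀ f) (S.pt₁ f) (S.pt₂ f) (S.jac_ne_zero f) a b
  rw [tri, h, show cross _ _ = S.jac f from rfl, abs_jac, cen, inner_smul_right, inner_add_right,
    inner_add_right]
  ring

theorem setIntegral_tri_const (f : F) (c : ℝ) : ∫ _ in S.tri f, c = S.area f * c :=
  S.setIntegral_tri_affine f (g := fun _ => c) (a := 0) (b := c) (by simp)

theorem setIntegral_tri_inner {u : VField F} (hu : AffineVector u) (f : F) (c : Plane) :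
    ∫ x in S.tri f, inner ℝ (u f x) c = S.area f * inner ℝ (u f (S.cen f)) c := by
  obtain ⟨a, b, h⟩ := hu f
  refine S.setIntegral_tri_affine f (g := fun x => inner ℝ (u f x) c) (a := b • c)
    (b := inner ℝ a c) fun x => ?_
  simp only [h, inner_add_left, inner_smul_left, conj_trivial, real_inner_comm]
  ring

theorem affineScalar_lagrange (h₀ h₁ h₂ : F → ℝ) : AffineScalar (S.lagrange h₀ h₁ h₂) :=
  fun _ => ⟨_, _, fun _ => rfl⟩

theorem affineVector_rt (s₀ s₁ s₂ : F → ℝ) : AffineVector (S.rt s₀ s₁ s₂) :=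
  fun _ => ⟨_, _, fun _ => rfl⟩

/-- Integration by parts on one facet. -/
theorem setIntegral_div_mul_add {u : VField F} (hu : AffineVector u) {q : SField F}
    (hq : AffineScalar q) (f : F) :
    (∫ x in S.tri f, div u f x * q f x) + ∫ x in S.tri f, inner ℝ (u f x) (grad q f x) =
      -(S.sg f * (S.flux₀ u f * ((q f (S.pt₁ f) + q f (S.pt₂ f)) / 2))) -
      (S.sg f * (S.flux₁ u f * ((q f (S.pt₀ f) + q f (S.pt₂ f)) / 2))) -
      (S.sg f * (S.flux₂ u f * ((q f (S.pt₀ f) + q f (S.pt₁ f)) / 2))) := by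
  obtain ⟨g, c, h'⟩ := hq f
  have hgrad : ∀ x, grad q f x = g := fun x => gradient_affine h' x
  simp only [hgrad]
  rw [S.setIntegral_tri_inner hu]
  obtain ⟨a, b, h⟩ := hu f
  have hdiv : ∀ x, div u f x = 2 * b := fun x => pdiv_affine h x
  -- Since `div u` is constant, the product is affine and the barycentre rule is exact. What remains
  -- is a polynomial identity in the corner coordinates, with `-sg * flux` the outward flux through
  -- a side.
  rw [S.setIntegral_tri_affine f (g := fun x => div u f x * q f x) (a := (2 * b) • g)
    (b := 2 * b * c) fun x => by
      simp only [hdiv, h', inner_smul_left, conj_trivial]; ring]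
  simp only [hdiv, h', h, area, cen, flux₀, flux₁, flux₂, jac, cross, inner_plane, PiLp.add_apply,
    PiLp.smul_apply, PiLp.sub_apply, smul_eq_mul]
  ring

/-- Reindexing by `ρ` shows that the sum is its own negative. The predicate allows restriction to a
`ρ`-invariant set of facets, such as a cell or one side of an edge. -/
theorem sum_eq_zero_of_invol [Fintype F] {ρ : F → F} (hρ : ∀ f, ρ (ρ f) = f) {P : F → Prop}
    [DecidablePred P] (hP : ∀ f, P (ρ f) ↔ P f) {X : F → ℝ} (hX : ∀ f, X (ρ f) = -X f) :
    ∑ f with P f, X f = 0 := by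
  have h : ∑ f with P f, X f = ∑ f with P f, X (ρ f) :=
    Finset.sum_nbij' ρ ρ (by simp [hP]) (by simp [hP]) (by simp [hρ]) (by simp [hρ])
      (by simp [hρ])
  simp only [hX, Finset.sum_neg_distrib] at h
  linarith

/-- Integration by parts on the surface. -/
theorem sInner_div_add_vInner_grad [Fintype F] {u : VField F} (hu : u ∈ S.RT0) {q : SField F}
    (hq : q ∈ S.P1) : S.sInner (div u) q + S.vInner u (grad q) = 0 := by
  obtain ⟨ha, h₀, h₁, h₂⟩ := (S.mem_RT0_iff u).mp hu
  have hqa : AffineScalar q := hq.1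
  obtain ⟨k₀, k₁, k₂, rfl⟩ := (S.mem_P1_iff q).mp hq
  rw [sInner, vInner, ← Finset.sum_add_distrib]
  simp only [S.setIntegral_div_mul_add ha hqa, lagrange_pt₀, lagrange_pt₁, lagrange_pt₂,
    Function.comp]
  rw [Finset.sum_sub_distrib, Finset.sum_sub_distrib]
  -- A trivial filter gives the shape of `sum_eq_zero_of_invol`. Flux and side mean agree on the two
  -- facets at a side while `sg` changes sign.
  have t : ∀ X : F → ℝ, ∑ f, X f = ∑ f with True, X f := by simp
  rw [t, t fun f => S.sg f * (S.flux₁ u f * _), t fun f => S.sg f * (S.flux₂ u f * _),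
    sum_eq_zero_of_invol S.ρ₀_invol, sum_eq_zero_of_invol S.ρ₁_invol,
    sum_eq_zero_of_invol S.ρ₂_invol]
  · simp
  · simp
  · intro f; rw [sg_ρ₂, h₂, vtx_ρ₂, edge_ρ₂]; ring
  · simp
  · intro f; rw [sg_ρ₁, h₁, vtx_ρ₁, cell_ρ₁]; ring
  · simp
  · intro f; rw [sg_ρ₀, h₀, edge_ρ₀, cell_ρ₀]; ring

/-! ### Bilinearity and definiteness of the inner products -/

variable [Fintype F]

theorem sInner_comm (p q : SField F) : S.sInner p q = S.sInner q p := by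
  simp only [sInner, mul_comm]

theorem vInner_comm (u w : VField F) : S.vInner u w = S.vInner w u := by
  simp only [vInner, real_inner_comm]

theorem sInner_sum_smul {ι : Type*} [Fintype ι] (p : SField F) (hp : ∀ f, Continuous (p f))
    (c : ι → ℝ) (q : ι → SField F) (hq : ∀ i f, Continuous (q i f)) :
    S.sInner p (∑ i, c i • q i) = ∑ i, c i * S.sInner p (q i) := by
  simp only [sInner, Finset.mul_sum]
  rw [Finset.sum_comm]
  refine Finset.sum_congr rfl fun f _ => ?_
  simp only [← integral_const_mul]
  rw [← integral_finsetSum (f := fun i x => c i * (p f x * q i f x)) _ fun i _ =>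
    S.integrableOn_tri (continuous_const.mul ((hp f).mul (hq i f))) f]
  congr 1
  funext x
  simp only [Finset.sum_apply, Pi.smul_apply, smul_eq_mul, Finset.mul_sum]
  exact Finset.sum_congr rfl fun i _ => by ring

theorem vInner_sum_smul {ι : Type*} [Fintype ι] (u : VField F) (hu : ∀ f, Continuous (u f))
    (c : ι → ℝ) (w : ι → VField F) (hw : ∀ i f, Continuous (w i f)) :
    S.vInner u (∑ i, c i • w i) = ∑ i, c i * S.vInner u (w i) := by
  simp only [vInner, Finset.mul_sum]
  rw [Finset.sum_comm]
  refine Finset.sum_congr rfl fun f _ => ?_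
  simp only [← integral_const_mul]
  rw [← integral_finsetSum (f := fun i x => c i * inner ℝ (u f x) (w i f x)) _ fun i _ =>
    S.integrableOn_tri (continuous_const.mul ((hu f).inner (𝕜 := ℝ) (hw i f))) f]
  congr 1
  funext x
  simp only [Finset.sum_apply, Pi.smul_apply, inner_sum, inner_smul_right]

theorem sum_smul_sInner {ι : Type*} [Fintype ι] (p : SField F) (hp : ∀ f, Continuous (p f))
    (c : ι → ℝ) (q : ι → SField F) (hq : ∀ i f, Continuous (q i f)) :
    S.sInner (∑ i, c i • q i) p = ∑ i, c i * S.sInner (q i) p := by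
  rw [sInner_comm, S.sInner_sum_smul p hp c q hq]
  simp only [S.sInner_comm p]

theorem sum_smul_vInner {ι : Type*} [Fintype ι] (u : VField F) (hu : ∀ f, Continuous (u f))
    (c : ι → ℝ) (w : ι → VField F) (hw : ∀ i f, Continuous (w i f)) :
    S.vInner (∑ i, c i • w i) u = ∑ i, c i * S.vInner (w i) u := by
  rw [vInner_comm, S.vInner_sum_smul u hu c w hw]
  simp only [S.vInner_comm u]

theorem eq_zero_of_sInner_self {q : SField F} (hq : ∀ f, Continuous (q f))
    (h : S.sInner q q = 0) (f : F) {x : Plane} (hx : x ∈ S.tri f) : q f x = 0 := by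
  rw [sInner, Finset.sum_eq_zero_iff_of_nonneg fun f _ =>
    integral_nonneg fun x => mul_self_nonneg _] at h
  exact mul_self_eq_zero.mp (eq_zero_of_setIntegral_tri (S.jac_ne_zero f)
    ((hq f).mul (hq f)) (fun x => mul_self_nonneg _) (h f (Finset.mem_univ f)) x hx)

theorem eq_zero_of_vInner_self {u : VField F} (hu : ∀ f, Continuous (u f))
    (h : S.vInner u u = 0) (f : F) {x : Plane} (hx : x ∈ S.tri f) : u f x = 0 := by
  rw [vInner, Finset.sum_eq_zero_iff_of_nonneg fun f _ =>
    integral_nonneg fun x => real_inner_self_nonneg] at h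
  exact inner_self_eq_zero.mp (eq_zero_of_setIntegral_tri (S.jac_ne_zero f)
    ((hu f).inner (hu f)) (fun x => real_inner_self_nonneg) (h f (Finset.mem_univ f)) x hx)

end Mesh

theorem cross_add_left (a b c : Plane) : cross (a + b) c = cross a c + cross b c := by
  simp [cross]; ring

theorem cross_smul_left (r : ℝ) (a c : Plane) : cross (r • a) c = r * cross a c := by
  simp [cross]; ring

/-! ### Discrete harmonicity as one equation per cell -/

namespace Mesh

variable {F V E C : Type*} (S : Mesh F V E C)

/-- All facets of a cell share the centre value, so on a cell every test function is a multiple of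
one hat function. -/
theorem lagGrad_smul (h : F → ℝ) (k : C → ℝ) (hk : h = k ∘ S.cell) (f : F) :
    S.lagGrad 0 0 h f = k (S.cell f) • S.lagGrad 0 0 1 f := by
  simp only [lagGrad, hk, Pi.zero_apply, Function.comp, Pi.one_apply, zero_smul, zero_add, one_smul,
    rot_smul]
  rw [smul_comm]

theorem lagGrad_center_ne_zero (f : F) : S.lagGrad 0 0 1 f ≠ 0 := by
  intro h
  have h₁ := S.lagrange_pt₁ 0 0 1 f
  have h₂ := S.lagrange_pt₂ 0 0 1 f
  simp [lagrange, h] at h₁ h₂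

/-- Vanishing at the two ends of the half edges removes the vertex and edge point values and leaves
only the centre values. -/
theorem mem_P1Zero_iff (η : SField F) :
    η ∈ S.P1Zero ↔ ∃ k : C → ℝ, η = S.lagrange 0 0 (k ∘ S.cell) := by
  constructor
  · rintro ⟨hη, h⟩
    obtain ⟨k₀, k₁, k₂, rfl⟩ := (S.mem_P1_iff η).mp hη
    refine ⟨k₂, ?_⟩
    congr 1 <;> funext f
    · have := h f 1 (by simp)
      rwa [AffineMap.lineMap_apply_one, lagrange_pt₀] at this
    · have := h f 0 (by simp)
      rwa [AffineMap.lineMap_apply_zero, lagrange_pt₁] at this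
  · rintro ⟨k, rfl⟩
    refine ⟨(S.mem_P1_iff _).mpr ⟨0, 0, k, rfl⟩, fun f t _ => ?_⟩
    rw [affine_lineMap (q := S.lagrange _ _ _ f) fun _ => rfl, lagrange_pt₁, lagrange_pt₀]
    simp

theorem gradPerp_lagrange (h₀ h₁ h₂ : F → ℝ) (f : F) (x : Plane) :
    gradPerp (S.lagrange h₀ h₁ h₂) f x = rot (S.lagGrad h₀ h₁ h₂ f) := by
  rw [gradPerp, grad_lagrange]

variable [Fintype F]

open Classical in
/-- Integral over the cell `i` of the inner product of a facetwise constant field with the gradient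
of the nodal function of the cell centre. -/
def moment (a : F → Plane) (i : C) : ℝ :=
  ∑ f with S.cell f = i, S.area f * inner ℝ (a f) (S.lagGrad 0 0 1 f)

theorem moment_add (a b : F → Plane) (i : C) :
    S.moment (a + b) i = S.moment a i + S.moment b i := by
  simp only [moment, Pi.add_apply, inner_add_left, mul_add, Finset.sum_add_distrib]

theorem moment_smul (c : ℝ) (a : F → Plane) (i : C) : S.moment (c • a) i = c * S.moment a i := by
  simp only [moment, Pi.smul_apply, inner_smul_left, conj_trivial, Finset.mul_sum]
  exact Finset.sum_congr rfl fun f _ => by ring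

theorem moment_cell_smul (k : C → ℝ) (a : F → Plane) (i : C) :
    S.moment (fun f => k (S.cell f) • a f) i = k i * S.moment a i := by
  classical
  simp only [moment, inner_smul_left, conj_trivial, Finset.mul_sum]
  refine Finset.sum_congr rfl fun f hf => ?_
  rw [← (Finset.mem_filter.mp hf).2]; ring

/-- This is the coefficient of the single free unknown of a cell. Its positivity gives both
existence and uniqueness of the harmonic extension. -/
theorem moment_self_pos (i : C) : 0 < S.moment (S.lagGrad 0 0 1) i := by
  classical
  refine Finset.sum_pos (fun f _ => mul_pos (S.area_pos f)
    (real_inner_self_pos.mpr (S.lagGrad_center_ne_zero f))) ?_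
  obtain ⟨f, hf⟩ := S.cell_surj i
  exact ⟨f, by simp [hf]⟩

theorem forall_cellIntegral_grad_iff {q : SField F} (hq : AffineScalar q) (i : C) :
    (∀ η ∈ S.P1Zero, S.cellIntegral i (fun f x => inner ℝ (grad q f x) (grad η f x)) = 0) ↔
      S.moment (fun f => grad q f (S.cen f)) i = 0 := by
  have key : ∀ k : C → ℝ, S.cellIntegral i (fun f x => inner ℝ (grad q f x)
      (grad (S.lagrange 0 0 (k ∘ S.cell)) f x)) =
      k i * S.moment (fun f => grad q f (S.cen f)) i := by
    classical
    intro k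
    rw [cellIntegral, moment, Finset.mul_sum]
    refine Finset.sum_congr rfl fun f hf => ?_
    simp only [grad_lagrange, S.lagGrad_smul _ k rfl, hq.grad_eq f _ (S.cen f)]
    rw [setIntegral_tri_const, inner_smul_right, (Finset.mem_filter.mp hf).2]
    ring
  constructor
  · intro h
    have := h _ ((S.mem_P1Zero_iff _).mpr ⟨1, rfl⟩)
    rwa [key, Pi.one_apply, one_mul] at this
  · intro h η hη
    obtain ⟨k, rfl⟩ := (S.mem_P1Zero_iff _).mp hη
    rw [key, h, mul_zero]

/-- Moving the rotation to the other factor, `u · rot g = (-rot u) · g`, makes the curl condition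
the same moment as in the scalar case. Tested against a constant, the affine field enters only
through its barycentre value. -/
theorem forall_cellIntegral_gradPerp_iff {u : VField F} (hu : AffineVector u) (i : C) :
    (∀ η ∈ S.P1Zero, S.cellIntegral i (fun f x => inner ℝ (u f x) (gradPerp η f x)) = 0) ↔
      S.moment (fun f => -rot (u f (S.cen f))) i = 0 := by
  have key : ∀ k : C → ℝ, S.cellIntegral i (fun f x => inner ℝ (u f x)
      (gradPerp (S.lagrange 0 0 (k ∘ S.cell)) f x)) =
      k i * S.moment (fun f => -rot (u f (S.cen f))) i := by
    classical
    intro k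
    rw [cellIntegral, moment, Finset.mul_sum]
    refine Finset.sum_congr rfl fun f hf => ?_
    simp only [gradPerp_lagrange, S.lagGrad_smul _ k rfl]
    rw [S.setIntegral_tri_inner hu, rot_smul, inner_smul_right, inner_neg_left, inner_rot_left,
      (Finset.mem_filter.mp hf).2]
    ring
  constructor
  · intro h
    have := h _ ((S.mem_P1Zero_iff _).mpr ⟨1, rfl⟩)
    rwa [key, Pi.one_apply, one_mul] at this
  · intro h η hη
    obtain ⟨k, rfl⟩ := (S.mem_P1Zero_iff _).mp hη
    rw [key, h, mul_zero]

omit [Fintype F] in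
theorem inner_grad_smul_unitTangent {q : SField F} (hq : AffineScalar q) (f : F) (x : Plane) :
    inner ℝ (grad q f x) (((S.head f : ℤ) : ℝ) • unitTangent (S.pt₁ f) (S.pt₀ f)) =
      S.hd f * ((S.len f)⁻¹ * (q f (S.pt₀ f) - q f (S.pt₁ f))) := by
  obtain ⟨a, b, h⟩ := hq f
  rw [inner_smul_right, inner_unitTangent, grad, gradient_affine h, h, h, inner_sub_right, len, hd]
  ring

omit [Fintype F] in
theorem inner_smul_unitNormal {u : VField F} (hu : AffineVector u) (f : F) (t : ℝ) :
    inner ℝ (u f (AffineMap.lineMap (S.pt₁ f) (S.pt₀ f) t))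
      (((S.head f : ℤ) : ℝ) • unitNormal (S.pt₁ f) (S.pt₀ f)) =
      S.hd f * -((S.len f)⁻¹ * S.flux₂ u f) := by
  rw [inner_smul_right, S.normal_pt₁_pt₀ hu, hd]

theorem forall_exists_eq_iff {X Y : Type*} (g : X → Y) (h : X → ℝ) :
    (∀ y, ∃ c : ℝ, ∀ x, g x = y → h x = c) ↔ ∃ c : Y → ℝ, ∀ x, h x = c (g x) := by
  rw [Classical.skolem]
  exact exists_congr fun c => ⟨fun H x => H _ x rfl, fun H y x hx => hx ▸ H x⟩

/-- All conditions become equations between corner values; the edge condition does not depend on the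
position along the half edge. -/
theorem mem_V0_iff (q : SField F) : q ∈ S.V0 ↔ q ∈ S.P1 ∧
    (∃ c : E → ℝ, ∀ f, S.hd f * ((S.len f)⁻¹ * (q f (S.pt₀ f) - q f (S.pt₁ f))) = c (S.edge f)) ∧
      ∀ i, S.moment (fun f => grad q f (S.cen f)) i = 0 := by
  refine and_congr_right fun hq => and_congr ?_
    (forall_congr' fun i => S.forall_cellIntegral_grad_iff hq.1 i)
  rw [← forall_exists_eq_iff]
  refine forall_congr' fun e => exists_congr fun c => forall_congr' fun f =>
    imp_congr_right fun _ => ?_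
  simp only [S.inner_grad_smul_unitTangent hq.1]
  exact ⟨fun h => h 0 (by simp), fun h _ _ => h⟩

theorem mem_V1_iff (u : VField F) : u ∈ S.V1 ↔ u ∈ S.RT0 ∧
    (∃ c : E → ℝ, ∀ f, S.hd f * -((S.len f)⁻¹ * S.flux₂ u f) = c (S.edge f)) ∧
      (∃ d : C → ℝ, ∀ f, div u f 0 = d (S.cell f)) ∧
        ∀ i, S.moment (fun f => -rot (u f (S.cen f))) i = 0 := by
  refine and_congr_right fun hu => and_congr ?_ (and_congr ?_
    (forall_congr' fun i => S.forall_cellIntegral_gradPerp_iff hu.1 i))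
  · rw [← forall_exists_eq_iff]
    refine forall_congr' fun e => exists_congr fun c => forall_congr' fun f =>
      imp_congr_right fun _ => ?_
    simp only [S.inner_smul_unitNormal hu.1]
    exact ⟨fun h => h 0 (by simp), fun h _ _ => h⟩
  · rw [← forall_exists_eq_iff]
    refine forall_congr' fun e => exists_congr fun c => forall_congr' fun f =>
      imp_congr_right fun _ => ?_
    exact ⟨fun h => h 0, fun h x => by rw [AffineVector.div_eq hu.1 f x 0, h]⟩

/-! ### Linear structure of the spaces -/

omit [Fintype F] in
theorem add_mem_P1 {p q : SField F} (hp : p ∈ S.P1) (hq : q ∈ S.P1) : p + q ∈ S.P1 :=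
  ⟨AffineScalar.add hp.1 hq.1,
    fun f t ht => congrArg₂ (· + ·) (hp.2.1 f t ht) (hq.2.1 f t ht),
    fun f t ht => congrArg₂ (· + ·) (hp.2.2.1 f t ht) (hq.2.2.1 f t ht),
    fun f t ht => congrArg₂ (· + ·) (hp.2.2.2 f t ht) (hq.2.2.2 f t ht)⟩

omit [Fintype F] in
theorem smul_mem_P1 (c : ℝ) {q : SField F} (hq : q ∈ S.P1) : c • q ∈ S.P1 :=
  ⟨AffineScalar.smul c hq.1, fun f t ht => congrArg (c • ·) (hq.2.1 f t ht),
    fun f t ht => congrArg (c • ·) (hq.2.2.1 f t ht),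
    fun f t ht => congrArg (c • ·) (hq.2.2.2 f t ht)⟩

omit [Fintype F] in
theorem flux₀_add (u v : VField F) : S.flux₀ (u + v) = S.flux₀ u + S.flux₀ v :=
  funext fun _ => cross_add_left _ _ _

omit [Fintype F] in
theorem flux₁_add (u v : VField F) : S.flux₁ (u + v) = S.flux₁ u + S.flux₁ v :=
  funext fun _ => cross_add_left _ _ _

omit [Fintype F] in
theorem flux₂_add (u v : VField F) : S.flux₂ (u + v) = S.flux₂ u + S.flux₂ v :=
  funext fun _ => cross_add_left _ _ _

omit [Fintype F] in
theorem flux₀_smul (c : ℝ) (u : VField F) : S.flux₀ (c • u) = c • S.flux₀ u :=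
  funext fun _ => cross_smul_left _ _ _

omit [Fintype F] in
theorem flux₁_smul (c : ℝ) (u : VField F) : S.flux₁ (c • u) = c • S.flux₁ u :=
  funext fun _ => cross_smul_left _ _ _

omit [Fintype F] in
theorem flux₂_smul (c : ℝ) (u : VField F) : S.flux₂ (c • u) = c • S.flux₂ u :=
  funext fun _ => cross_smul_left _ _ _

omit [Fintype F] in
theorem add_mem_RT0 {u v : VField F} (hu : u ∈ S.RT0) (hv : v ∈ S.RT0) : u + v ∈ S.RT0 := by
  rw [mem_RT0_iff] at *
  refine ⟨AffineVector.add hu.1 hv.1, ?_⟩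
  simp only [flux₀_add, flux₁_add, flux₂_add, Pi.add_apply, hu.2.1, hv.2.1, hu.2.2.1, hv.2.2.1,
    hu.2.2.2, hv.2.2.2, implies_true, and_self]

omit [Fintype F] in
theorem smul_mem_RT0 (c : ℝ) {u : VField F} (hu : u ∈ S.RT0) : c • u ∈ S.RT0 := by
  rw [mem_RT0_iff] at *
  refine ⟨AffineVector.smul c hu.1, ?_⟩
  simp only [flux₀_smul, flux₁_smul, flux₂_smul, Pi.smul_apply, hu.2.1, hu.2.2.1, hu.2.2.2,
    implies_true, and_self]

theorem add_mem_V0 {p q : SField F} (hp : p ∈ S.V0) (hq : q ∈ S.V0) : p + q ∈ S.V0 := by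
  rw [mem_V0_iff] at *
  obtain ⟨hp, ⟨c, hc⟩, hp'⟩ := hp
  obtain ⟨hq, ⟨d, hd⟩, hq'⟩ := hq
  refine ⟨S.add_mem_P1 hp hq, ⟨c + d, fun f => ?_⟩, fun i => ?_⟩
  · rw [Pi.add_apply c, ← hc, ← hd]; simp only [Pi.add_apply]; ring
  · rw [AffineScalar.grad_add hp.1 hq.1]
    exact (S.moment_add _ _ i).trans (by rw [hp', hq', add_zero])

theorem smul_mem_V0 (r : ℝ) {q : SField F} (hq : q ∈ S.V0) : r • q ∈ S.V0 := by
  rw [mem_V0_iff] at *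
  obtain ⟨hq, ⟨d, hd⟩, hq'⟩ := hq
  refine ⟨S.smul_mem_P1 r hq, ⟨r • d, fun f => ?_⟩, fun i => ?_⟩
  · rw [Pi.smul_apply r d, ← hd]; simp only [Pi.smul_apply, smul_eq_mul]; ring
  · rw [AffineScalar.grad_smul r hq.1]
    exact (S.moment_smul _ _ i).trans (by rw [hq', mul_zero])

theorem add_mem_V1 {u v : VField F} (hu : u ∈ S.V1) (hv : v ∈ S.V1) : u + v ∈ S.V1 := by
  rw [mem_V1_iff] at *
  obtain ⟨hu, ⟨c, hc⟩, ⟨d, hd⟩, hu'⟩ := hu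
  obtain ⟨hv, ⟨c', hc'⟩, ⟨d', hd'⟩, hv'⟩ := hv
  refine ⟨S.add_mem_RT0 hu hv, ⟨c + c', fun f => ?_⟩, ⟨d + d', fun f => ?_⟩, fun i => ?_⟩
  · rw [Pi.add_apply, ← hc, ← hc', flux₂_add, Pi.add_apply]; ring
  · rw [AffineVector.div_add hu.1 hv.1, Pi.add_apply, Pi.add_apply, hd, hd', Pi.add_apply]
  · rw [← add_zero (0 : ℝ)]
    nth_rw 1 [← hu' i]
    rw [← hv' i, ← moment_add]
    congr 1; funext f
    simp only [Pi.add_apply, rot_add, neg_add]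

theorem smul_mem_V1 (r : ℝ) {u : VField F} (hu : u ∈ S.V1) : r • u ∈ S.V1 := by
  rw [mem_V1_iff] at *
  obtain ⟨hu, ⟨c, hc⟩, ⟨d, hd⟩, hu'⟩ := hu
  refine ⟨S.smul_mem_RT0 r hu, ⟨r • c, fun f => ?_⟩, ⟨r • d, fun f => ?_⟩, fun i => ?_⟩
  · rw [Pi.smul_apply, ← hc, flux₂_smul, Pi.smul_apply]; simp only [smul_eq_mul]; ring
  · rw [AffineVector.div_smul r hu.1, Pi.smul_apply, Pi.smul_apply, hd, Pi.smul_apply]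
  · rw [← mul_zero r, ← hu' i, ← moment_smul]
    congr 1; funext f
    simp only [Pi.smul_apply, rot_smul, smul_neg]

/-! ### The rotated gradient, and uniqueness from the degrees of freedom -/

omit [Fintype F] in
theorem affineVector_gradPerp {q : SField F} (hq : AffineScalar q) : AffineVector (gradPerp q) :=
  fun f => ⟨rot (grad q f 0), 0, fun x => by
    rw [gradPerp, hq.grad_eq f x 0, zero_smul, add_zero]⟩

omit [Fintype F] in
-- `q` is a stream function of its rotated gradient: the flux through a segment is the difference of
-- the end values.
theorem cross_gradPerp {q : SField F} (hq : AffineScalar q) (f : F) (x A B : Plane) :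
    cross (gradPerp q f x) (B - A) = q f A - q f B := by
  obtain ⟨a, b, h⟩ := hq f
  rw [gradPerp, grad, gradient_affine h, h, h, ← inner_neg_rot, inner_neg_right, inner_rot_rot,
    inner_sub_right]
  ring

omit [Fintype F] in
theorem flux₀_gradPerp {q : SField F} (hq : AffineScalar q) (f : F) :
    S.flux₀ (gradPerp q) f = q f (S.pt₁ f) - q f (S.pt₂ f) := cross_gradPerp hq f _ _ _

omit [Fintype F] in
theorem flux₁_gradPerp {q : SField F} (hq : AffineScalar q) (f : F) :
    S.flux₁ (gradPerp q) f = q f (S.pt₂ f) - q f (S.pt₀ f) := cross_gradPerp hq f _ _ _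

omit [Fintype F] in
theorem flux₂_gradPerp {q : SField F} (hq : AffineScalar q) (f : F) :
    S.flux₂ (gradPerp q) f = q f (S.pt₀ f) - q f (S.pt₁ f) := cross_gradPerp hq f _ _ _

omit [Fintype F] in
theorem div_eq_flux {u : VField F} (hu : AffineVector u) (f : F) (x : Plane) :
    div u f x = 2 * (-(S.flux₀ u f + S.flux₁ u f + S.flux₂ u f) / S.jac f) := by
  conv_lhs => rw [S.eq_rt hu]
  rw [div_rt]

omit [Fintype F] in
theorem ext_flux {u v : VField F} (hu : AffineVector u) (hv : AffineVector v)
    (h₀ : S.flux₀ u = S.flux₀ v) (h₁ : S.flux₁ u = S.flux₁ v) (h₂ : S.flux₂ u = S.flux₂ v) :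
    u = v := by
  rw [S.eq_rt hu, S.eq_rt hv, h₀, h₁, h₂]

omit [Fintype F] in
theorem gradPerp_mem_RT0 {q : SField F} (hq : q ∈ S.P1) : gradPerp q ∈ S.RT0 := by
  rw [mem_RT0_iff]
  refine ⟨affineVector_gradPerp hq.1, ?_⟩
  simp only [S.flux₀_gradPerp hq.1, S.flux₁_gradPerp hq.1, S.flux₂_gradPerp hq.1]
  obtain ⟨k₀, k₁, k₂, rfl⟩ := (S.mem_P1_iff q).mp hq
  simp only [lagrange_pt₀, lagrange_pt₁, lagrange_pt₂, Function.comp, vtx_ρ₁, vtx_ρ₂, edge_ρ₀,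
    edge_ρ₂, cell_ρ₀, cell_ρ₁, implies_true, and_self]

/-- The rotated gradient maps `V₀` to `V₁`. -/
theorem gradPerp_mem_V1 {q : SField F} (hq : q ∈ S.V0) : gradPerp q ∈ S.V1 := by
  rw [mem_V0_iff] at hq
  obtain ⟨hq, ⟨c, hc⟩, hm⟩ := hq
  rw [mem_V1_iff]
  refine ⟨S.gradPerp_mem_RT0 hq, ⟨-c, fun f => ?_⟩, ⟨0, fun f => ?_⟩, fun i => ?_⟩
  · rw [S.flux₂_gradPerp hq.1, Pi.neg_apply, ← hc]; ring
  · rw [S.div_eq_flux (affineVector_gradPerp hq.1), S.flux₀_gradPerp hq.1,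
      S.flux₁_gradPerp hq.1, S.flux₂_gradPerp hq.1, Pi.zero_apply]
    ring
  -- Rotating twice gives a minus sign, so the discrete curl of `gradPerp q` is the discrete
  -- Laplacian of `q`.
  · rw [← hm i]
    congr 1; funext f
    rw [gradPerp, rot_rot, neg_neg]

omit [Fintype F] in
theorem lagrange_zero : S.lagrange 0 0 0 = 0 := by
  funext f x
  simp [lagrange, lagGrad, inner_plane]

/-- With zero end values, an edge point value would give slopes of opposite sign on the two halves
of the edge, so it vanishes. The centre value is then killed by the moment equation. -/
theorem eq_zero_of_mem_V0 {q : SField F} (hq : q ∈ S.V0) (h : ∀ f, q f (S.pt₀ f) = 0) : q = 0 := by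
  rw [mem_V0_iff] at hq
  obtain ⟨hq, ⟨c, hc⟩, hm⟩ := hq
  obtain ⟨k₀, k₁, k₂, rfl⟩ := (S.mem_P1_iff q).mp hq
  simp only [lagrange_pt₀, lagrange_pt₁] at h hc
  have h₀ : k₀ ∘ S.vtx = 0 := funext h
  have h₁ : k₁ ∘ S.edge = 0 := by
    funext f
    -- The slope on the half edge at `f` equals the slope on the other half, where `hd` has the
    -- opposite sign.
    have e := (hc f).trans ((congrArg c (S.edge_ρ₀ f)).symm.trans (hc (S.ρ₀ f)).symm)
    rw [h₀, hd_ρ₀] at e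
    simp only [Function.comp, Pi.zero_apply, edge_ρ₀, zero_sub] at e
    have hl := inv_pos.mpr (S.len_pos f)
    have hl' := inv_pos.mpr (S.len_pos (S.ρ₀ f))
    have hd := S.hd_mul_self f
    have : ((S.len f)⁻¹ + (S.len (S.ρ₀ f))⁻¹) * k₁ (S.edge f) = 0 := by
      linear_combination (-S.hd f) * e -
        ((S.len f)⁻¹ + (S.len (S.ρ₀ f))⁻¹) * k₁ (S.edge f) * hd
    exact (mul_eq_zero.mp this).resolve_left (by positivity)
  rw [h₀, h₁] at hm ⊢
  have h₂ : k₂ = 0 := by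
    funext i
    have := hm i
    simp only [grad_lagrange, S.lagGrad_smul _ k₂ rfl] at this
    rw [moment_cell_smul] at this
    exact (mul_eq_zero.mp this).resolve_right (S.moment_self_pos i).ne'
  rw [h₂]
  exact S.lagrange_zero

open Classical in
/-- Divergence theorem on a cell. -/
theorem sum_area_mul_div {u : VField F} (hu : u ∈ S.RT0) (i : C) :
    ∑ f with S.cell f = i, S.area f * div u f 0 =
      -∑ f with S.cell f = i, S.sg f * S.flux₂ u f := by
  obtain ⟨ha, h₀, h₁, -⟩ := (S.mem_RT0_iff u).mp hu
  have h : ∀ f, S.area f * div u f 0 = -(S.sg f * S.flux₀ u f) - S.sg f * S.flux₁ u f -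
      S.sg f * S.flux₂ u f := by
    intro f
    rw [S.div_eq_flux ha, area]
    have := S.jac_ne_zero f
    field_simp
    ring
  simp only [h, Finset.sum_sub_distrib, Finset.sum_neg_distrib]
  -- The reflections `ρ₀` and `ρ₁` stay in the cell, so fluxes through inner sides cancel and only
  -- those through the edges survive.
  rw [sum_eq_zero_of_invol S.ρ₀_invol, sum_eq_zero_of_invol S.ρ₁_invol]
  · ring
  · simp [cell_ρ₁]
  · intro f; rw [sg_ρ₁, h₁]; ring
  · simp [cell_ρ₀]
  · intro f; rw [sg_ρ₀, h₀]; ring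

open Classical in
/-- Area of a cell. -/
def cellArea (i : C) : ℝ := ∑ f with S.cell f = i, S.area f

theorem cellArea_pos (i : C) : 0 < S.cellArea i := by
  refine Finset.sum_pos (fun f _ => S.area_pos f) ?_
  obtain ⟨f, hf⟩ := S.cell_surj i
  exact ⟨f, by simp [hf]⟩

/-- Without edge flux the constant divergence is zero by the divergence theorem. Then the flux
circulating around the centre is the same through all inner sides, so the field is the rotated
gradient of a multiple of the centre hat function, and zero discrete curl makes the multiple vanish.
-/
theorem eq_zero_of_mem_V1 {u : VField F} (hu : u ∈ S.V1) (h : S.flux₂ u = 0) : u = 0 := by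
  classical
  rw [mem_V1_iff] at hu
  obtain ⟨hu, -, ⟨d, hd⟩, hm⟩ := hu
  have hd0 : d = 0 := by
    funext i
    have := S.sum_area_mul_div hu i
    rw [h, Finset.sum_congr rfl (g := fun f => S.area f * d i) fun f hf => by
      rw [hd, (Finset.mem_filter.mp hf).2], ← Finset.sum_mul] at this
    simp only [Pi.zero_apply, mul_zero, Finset.sum_const_zero, neg_zero] at this
    exact (mul_eq_zero.mp this).resolve_left (S.cellArea_pos i).ne'
  obtain ⟨ha, h₀, h₁, -⟩ := (S.mem_RT0_iff u).mp hu
  have hs : ∀ f, S.flux₁ u f = -S.flux₀ u f := by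
    intro f
    have := hd f
    rw [S.div_eq_flux ha, hd0, h, Pi.zero_apply, Pi.zero_apply] at this
    have hj := S.jac_ne_zero f
    field_simp at this
    linarith
  -- The function `k` is the centre value of the stream function that vanishes on the edges.
  obtain ⟨k, hk⟩ := S.exists_cell_function (h := fun f => -S.flux₀ u f)
    (fun f => by rw [← hs, ← hs, h₁]) (fun f => by rw [h₀])
  have hA := S.affineScalar_lagrange 0 0 (k ∘ S.cell)
  have e : u = gradPerp (S.lagrange 0 0 (k ∘ S.cell)) := by
    apply S.ext_flux ha (affineVector_gradPerp hA) <;> funext f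
    · rw [S.flux₀_gradPerp hA, lagrange_pt₁, lagrange_pt₂, ← hk]; simp
    · rw [S.flux₁_gradPerp hA, lagrange_pt₂, lagrange_pt₀, ← hk, hs]; simp
    · rw [S.flux₂_gradPerp hA, lagrange_pt₀, lagrange_pt₁, h]; simp
  have hk0 : k = 0 := by
    funext i
    have := hm i
    simp only [e, gradPerp_lagrange, rot_rot, neg_neg, S.lagGrad_smul _ k rfl] at this
    rw [moment_cell_smul] at this
    exact (mul_eq_zero.mp this).resolve_right (S.moment_self_pos i).ne'
  rw [e, hk0]
  funext f x
  rw [gradPerp_lagrange, S.lagGrad_smul _ 0 rfl, Pi.zero_apply, zero_smul]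
  exact plane_ext (by simp) (by simp)

end Mesh

/-! ### Incidence matrices and sums over edges -/

namespace Mesh

variable {F V E C : Type*} (S : Mesh F V E C)

theorem side_ρ₀ (f : F) : S.side (S.ρ₀ f) = S.side f := by
  simp [side, S.sgn_ρ₀, S.head_ρ₀]

theorem side_ρ₂ (f : F) : S.side (S.ρ₂ f) = -S.side f := by
  simp [side, S.sgn_ρ₂, S.head_ρ₂]

theorem edge_cases {f g : F} (h : S.edge g = S.edge f) :
    g = f ∨ g = S.ρ₀ f ∨ g = S.ρ₂ f ∨ g = S.ρ₀ (S.ρ₂ f) :=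
  (S.edge_eq_iff f g).mp h.symm

theorem exists_left (e : E) : ∃ f, S.edge f = e ∧ S.side f = 1 := by
  obtain ⟨f, rfl⟩ := S.edge_surj e
  rcases Int.units_eq_one_or (S.side f) with h | h
  · exact ⟨f, rfl, h⟩
  · exact ⟨S.ρ₂ f, S.edge_ρ₂ f, by rw [side_ρ₂, h, neg_neg]⟩

theorem exists_left_head (e : E) : ∃ f, S.edge f = e ∧ S.side f = 1 ∧ S.head f = 1 := by
  obtain ⟨f, rfl, hf⟩ := S.exists_left e
  rcases Int.units_eq_one_or (S.head f) with h | h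
  · exact ⟨f, rfl, hf, h⟩
  · exact ⟨S.ρ₀ f, S.edge_ρ₀ f, by rw [side_ρ₀, hf], by rw [S.head_ρ₀, h, neg_neg]⟩

theorem units_one_ne_neg_one : (1 : ℤˣ) ≠ -1 := by decide

theorem ρ₀_ne (f : F) : S.ρ₀ f ≠ f := fun h => S.vtx_ne f (by rw [h])

theorem vtx_ρ₀_ρ₂ (f : F) : S.vtx (S.ρ₀ (S.ρ₂ f)) = S.vtx (S.ρ₀ f) := by
  rw [S.ρ_comm, vtx_ρ₂]

/-- Of the four facets at the edge, `f` and `ρ₂ f` lie at the head and the other two at the tail. By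
`vtx_ne` the two indicators never overlap, so the nested conditional is their difference. -/
theorem D₁_apply [DecidableEq V] {f : F} (hf : S.head f = 1) (j : V) : S.D₁ (S.edge f) j =
    (if S.vtx f = j then 1 else 0) - if S.vtx (S.ρ₀ f) = j then 1 else 0 := by
  have h₁ : (∃ g, S.edge g = S.edge f ∧ S.vtx g = j ∧ S.head g = 1) ↔ S.vtx f = j := by
    refine ⟨?_, fun h => ⟨f, rfl, h, hf⟩⟩
    rintro ⟨g, hg, hj, hd⟩
    rcases S.edge_cases hg with rfl | rfl | rfl | rfl
    · exact hj
    · simp [S.head_ρ₀, hf, units_one_ne_neg_one.symm] at hd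
    · rwa [vtx_ρ₂] at hj
    · simp [S.head_ρ₀, S.head_ρ₂, hf, units_one_ne_neg_one.symm] at hd
  have h₂ : (∃ g, S.edge g = S.edge f ∧ S.vtx g = j ∧ S.head g = -1) ↔ S.vtx (S.ρ₀ f) = j := by
    refine ⟨?_, fun h => ⟨S.ρ₀ f, S.edge_ρ₀ f, h, by rw [S.head_ρ₀, hf]⟩⟩
    rintro ⟨g, hg, hj, hd⟩
    rcases S.edge_cases hg with rfl | rfl | rfl | rfl
    · simp [hf] at hd
    · exact hj
    · simp [S.head_ρ₂, hf] at hd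
    · rwa [vtx_ρ₀_ρ₂] at hj
  simp only [D₁, Matrix.of_apply, h₁, h₂]
  by_cases h : S.vtx f = j
  · have : S.vtx (S.ρ₀ f) ≠ j := h ▸ S.vtx_ne f
    simp [h, this]
  · simp only [h, if_false, zero_sub]
    split_ifs <;> simp

theorem D₂_apply [DecidableEq C] {f : F} (hf : S.side f = 1) (i : C) : S.D₂ i (S.edge f) =
    (if S.cell f = i then 1 else 0) - if S.cell (S.ρ₂ f) = i then 1 else 0 := by
  have h₁ : (∃ g, S.edge g = S.edge f ∧ S.cell g = i ∧ S.side g = 1) ↔ S.cell f = i := by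
    refine ⟨?_, fun h => ⟨f, rfl, h, hf⟩⟩
    rintro ⟨g, hg, hj, hd⟩
    rcases S.edge_cases hg with rfl | rfl | rfl | rfl
    · exact hj
    · rwa [cell_ρ₀] at hj
    · simp [side_ρ₂, hf, units_one_ne_neg_one.symm] at hd
    · simp [side_ρ₀, side_ρ₂, hf, units_one_ne_neg_one.symm] at hd
  have h₂ : (∃ g, S.edge g = S.edge f ∧ S.cell g = i ∧ S.side g = -1) ↔ S.cell (S.ρ₂ f) = i := by
    refine ⟨?_, fun h => ⟨S.ρ₂ f, S.edge_ρ₂ f, h, by rw [side_ρ₂, hf]⟩⟩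
    rintro ⟨g, hg, hj, hd⟩
    rcases S.edge_cases hg with rfl | rfl | rfl | rfl
    · simp [hf] at hd
    · simp [side_ρ₀, hf] at hd
    · exact hj
    · rwa [cell_ρ₀] at hj
  simp only [D₂, Matrix.of_apply, h₁, h₂]
  by_cases h : S.cell f = i
  · have : S.cell (S.ρ₂ f) ≠ i := h ▸ S.cell_ne f
    simp [h, this]
  · simp only [h, if_false, zero_sub]
    split_ifs <;> simp

theorem dual_side (f : F) : S.dual.side f = S.head f := by
  simp only [side, dual]
  rcases Int.units_eq_one_or (S.sgn f) with h | h <;> simp [h]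

theorem dual_head (f : F) : S.dual.head f = -S.side f := rfl

/-- The two factors `sgn` in the dual `side` cancel and leave `head`; the definitions then agree
entry by entry. -/
theorem D₂bar_eq : S.D₂bar = S.dual.D₂ := by
  ext j e
  have h : S.dual.side = S.head := funext S.dual_side
  simp only [D₂bar, D₂, D₁, Matrix.transpose_apply, Matrix.of_apply]
  rw [h]
  rfl

theorem D₁bar_eq : S.D₁bar = S.dual.D₁ := by
  classical
  ext e i
  obtain ⟨f, rfl, hf⟩ := S.exists_left e
  -- The dual tangent points out of the left cell into the right one, so the facet at its head is
  -- `ρ₂ f`.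
  have h := S.dual.D₁_apply (f := S.ρ₂ f) (by rw [dual_head, side_ρ₂, hf, neg_neg]) i
  have he : S.dual.edge (S.ρ₂ f) = S.edge f := S.edge_ρ₂ f
  have hc : S.dual.vtx (S.dual.ρ₀ (S.ρ₂ f)) = S.cell f := congrArg S.cell (S.ρ₂_invol f)
  rw [he, hc] at h
  rw [h, D₁bar, Matrix.neg_apply, Matrix.transpose_apply, S.D₂_apply hf, neg_sub]
  rfl

/-- The four facets are distinct: `vtx_ne` separates the two on the same side of the edge, `cell_ne`
separates the two sides. -/
theorem sum_edge [Fintype F] [DecidableEq E] (f : F) (X : F → ℝ) :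
    ∑ g with S.edge g = S.edge f, X g = X f + X (S.ρ₀ f) + X (S.ρ₂ f) + X (S.ρ₀ (S.ρ₂ f)) := by
  classical
  have h : (Finset.univ.filter fun g => S.edge g = S.edge f) =
      {f, S.ρ₀ f, S.ρ₂ f, S.ρ₀ (S.ρ₂ f)} := by
    ext g
    simp only [Finset.mem_filter, Finset.mem_univ, true_and, Finset.mem_insert,
      Finset.mem_singleton]
    rw [← S.edge_eq_iff, eq_comm]
  have n₁ : S.ρ₀ f ≠ f := S.ρ₀_ne f
  have n₂ : S.ρ₀ (S.ρ₂ f) ≠ S.ρ₂ f := S.ρ₀_ne _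
  have n : ∀ g g', S.cell g = S.cell f → S.cell g' = S.cell (S.ρ₂ f) → g ≠ g' := by
    rintro g _ h h' rfl
    exact S.cell_ne f (h'.symm.trans h)
  rw [h, Finset.sum_insert, Finset.sum_insert, Finset.sum_pair n₂.symm]
  · ring
  · simp only [Finset.mem_insert, Finset.mem_singleton, not_or]
    exact ⟨n _ _ (S.cell_ρ₀ f) rfl, n _ _ (S.cell_ρ₀ f) (S.cell_ρ₀ _)⟩
  · simp only [Finset.mem_insert, Finset.mem_singleton, not_or]
    exact ⟨n₁.symm, n _ _ rfl rfl, n _ _ rfl (S.cell_ρ₀ _)⟩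

theorem sum_left [Fintype F] [DecidableEq E] {f : F} (hf : S.side f = 1) (X : F → ℝ) :
    ∑ g with S.edge g = S.edge f ∧ S.side g = 1, X g = X f + X (S.ρ₀ f) := by
  rw [← Finset.filter_filter, Finset.sum_filter, sum_edge]
  simp [side_ρ₀, side_ρ₂, hf, units_one_ne_neg_one.symm]

theorem sum_left_of_invariant [Fintype F] [DecidableEq E] (f : F) {X : F → ℝ}
    (hX : ∀ g, X (S.ρ₂ g) = X g) :
    ∑ g with S.edge g = S.edge f ∧ S.side g = 1, X g = X f + X (S.ρ₀ f) := by
  rcases Int.units_eq_one_or (S.side f) with h | h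
  · exact S.sum_left h X
  · rw [← S.edge_ρ₂ f, S.sum_left (f := S.ρ₂ f) (by rw [side_ρ₂, h, neg_neg]), S.ρ_comm, hX, hX]

/-- Grouping by edges, an edge on the boundary of the cell contributes its two facets inside the
cell. By invariance under `ρ₂` they may be replaced by those to the left of the edge; the common
sign `side` is the entry of `D₂`. -/
theorem sum_cell [Fintype F] [Fintype E] [DecidableEq E] [DecidableEq C] (i : C) {X : F → ℝ}
    (hX : ∀ g, X (S.ρ₂ g) = X g) :
    ∑ f with S.cell f = i, ((S.side f : ℤ) : ℝ) * X f =
      ∑ e, S.D₂ i e * ∑ g with S.edge g = e ∧ S.side g = 1, X g := by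
  rw [← Finset.sum_fiberwise _ S.edge]
  refine Finset.sum_congr rfl fun e _ => ?_
  obtain ⟨f, rfl, hf⟩ := S.exists_left e
  rw [S.sum_left hf, S.D₂_apply hf, Finset.filter_filter]
  simp only [and_comm (a := S.cell _ = i)]
  rw [← Finset.filter_filter, Finset.sum_filter, sum_edge]
  simp only [side_ρ₀, side_ρ₂, hf, cell_ρ₀, hX, S.ρ_comm f]
  split_ifs <;> simp <;> simp_all [cell_ρ₀, ← S.ρ_comm]
  all_goals ring

theorem sum_head_mul_vtx [Fintype F] [Fintype V] [DecidableEq E] (e : E) (k : V → ℝ) :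
    ∑ g with S.edge g = e ∧ S.side g = 1, S.hd g * k (S.vtx g) = (S.D₁ *ᵥ k) e := by
  classical
  obtain ⟨f, rfl, hf, hh⟩ := S.exists_left_head e
  rw [S.sum_left hf, Matrix.mulVec, dotProduct]
  simp only [S.D₁_apply hh, sub_mul, Finset.sum_sub_distrib, ite_mul, one_mul, zero_mul,
    Finset.sum_ite_eq, Finset.mem_univ, if_true, hd_ρ₀]
  simp [hd, hh]
  ring

variable [Fintype F]

open Classical in
theorem edgeFlux_eq {u : VField F} (hu : AffineVector u) (e : E) : S.edgeFlux e u =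
    ∑ g with S.edge g = e ∧ S.side g = 1, S.hd g * -S.flux₂ u g := by
  rw [edgeFlux]
  refine Finset.sum_congr rfl fun f _ => ?_
  rw [lineIntegral]
  simp only [S.normal_pt₁_pt₀ hu]
  rw [intervalIntegral.integral_const, show dist (S.pt₁ f) (S.pt₀ f) = S.len f from rfl, hd]
  have := (S.len_pos f).ne'
  simp only [sub_zero, one_smul]
  field_simp

/-- Length of the edge at a facet. -/
def edgeLen (f : F) : ℝ := S.len f + S.len (S.ρ₀ f)

omit [Fintype F] in
theorem edgeLen_pos (f : F) : 0 < S.edgeLen f := add_pos (S.len_pos _) (S.len_pos _)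

omit [Fintype F] in
theorem edgeLen_ρ₀ (f : F) : S.edgeLen (S.ρ₀ f) = S.edgeLen f := by
  rw [edgeLen, S.ρ₀_invol, add_comm, edgeLen]

omit [Fintype F] in
theorem edgeLen_ρ₂ (f : F) : S.edgeLen (S.ρ₂ f) = S.edgeLen f := by
  rw [edgeLen, S.ρ_comm, len_ρ₂, len_ρ₂, edgeLen]

/-- A constant normal component distributes the flux over the two halves of the edge in proportion
to their lengths. -/
theorem flux₂_eq_of_mem_V1 {u : VField F} (hu : u ∈ S.V1) (f : F) :
    S.flux₂ u f = -(S.hd f * S.len f / S.edgeLen f * S.edgeFlux (S.edge f) u) := by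
  classical
  rw [mem_V1_iff] at hu
  obtain ⟨hu, ⟨c, hc⟩, -⟩ := hu
  have h : ∀ g, S.flux₂ u g = -(S.hd g * S.len g * c (S.edge g)) := by
    intro g
    rw [← hc]
    have := (S.len_pos g).ne'
    have hs := S.hd_mul_self g
    field_simp
    linear_combination (-S.flux₂ u g) * hs
  have h' : ∀ g, S.hd g * -S.flux₂ u g = S.len g * c (S.edge g) := by
    intro g
    rw [h]
    linear_combination (S.len g * c (S.edge g)) * S.hd_mul_self g
  rw [S.edgeFlux_eq hu.1]
  simp only [h']
  rw [S.sum_left_of_invariant f (fun g => by rw [len_ρ₂, edge_ρ₂]), edge_ρ₀, ← add_mul, h,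
    ← edgeLen]
  have := (S.edgeLen_pos f).ne'
  field_simp

theorem eq_of_mem_V1 {u v : VField F} (hu : u ∈ S.V1) (hv : v ∈ S.V1)
    (h : ∀ e, S.edgeFlux e u = S.edgeFlux e v) : u = v := by
  have hs : u + (-1 : ℝ) • v ∈ S.V1 := S.add_mem_V1 hu (S.smul_mem_V1 _ hv)
  have := S.eq_zero_of_mem_V1 hs (by
    rw [flux₂_add, flux₂_smul]
    funext f
    simp [S.flux₂_eq_of_mem_V1 hu, S.flux₂_eq_of_mem_V1 hv, h])
  rwa [neg_one_smul, ← sub_eq_add_neg, sub_eq_zero] at this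

end Mesh

namespace Mesh

variable {F V E C : Type*} (S : Mesh F V E C)

/-! ### Existence of elements with prescribed degrees of freedom -/

/-- The Laplace equation on the graph of facets, with edges across the sides in the interior of the
cells. -/
theorem exists_graph_laplace_solution [Fintype F] [Fintype C] [DecidableEq C] (r : F → ℝ)
    (hr : ∀ i, ∑ f with S.cell f = i, r f = 0) :
    ∃ g : F → ℝ, ∀ f, (g f - g (S.ρ₀ f)) + (g f - g (S.ρ₁ f)) = r f := by
  let T : EuclideanSpace ℝ F →ₗ[ℝ] EuclideanSpace ℝ F :=
    { toFun := fun g => WithLp.toLp 2 fun f => (g f - g (S.ρ₀ f)) + (g f - g (S.ρ₁ f))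
      map_add' := fun g h => by ext f; simp; ring
      map_smul' := fun c g => by ext f; simp; ring }
  -- Summation by parts. The operator is the graph Laplacian and this is its Dirichlet form; each
  -- side is counted from both facets, hence the halves.
  have hT : ∀ g h : EuclideanSpace ℝ F, inner ℝ (T g) h =
      (∑ f, (g f - g (S.ρ₀ f)) * (h f - h (S.ρ₀ f))) / 2 +
        (∑ f, (g f - g (S.ρ₁ f)) * (h f - h (S.ρ₁ f))) / 2 := by
    intro g h
    have key : ∀ ρ : F → F, (∀ f, ρ (ρ f) = f) →
        ∑ f, (g f - g (ρ f)) * h (ρ f) = -∑ f, (g f - g (ρ f)) * h f := by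
      intro ρ hρ
      rw [← Finset.sum_neg_distrib]
      refine Finset.sum_nbij' ρ ρ (by simp) (by simp) (by simp [hρ]) (by simp [hρ]) fun f _ => ?_
      rw [hρ]; ring
    simp only [mul_sub, Finset.sum_sub_distrib, key _ S.ρ₀_invol, key _ S.ρ₁_invol]
    simp only [PiLp.inner_apply, T, LinearMap.coe_mk, AddHom.coe_mk, RCLike.inner_apply,
      conj_trivial, mul_add, Finset.sum_add_distrib]
    simp only [mul_comm (h _)]
    ring
  have hsymm : T.IsSymmetric := fun g h => by
    rw [real_inner_comm _ g, hT, hT]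
    simp only [mul_comm]
  -- Fredholm alternative for a symmetric operator in finite dimension. Kernel elements have zero
  -- energy, so they are constant on each cell, and `hr` makes `r` orthogonal to them.
  have hrange : LinearMap.range T = (LinearMap.ker T)ᗮ := by
    rw [← hsymm.orthogonal_range, Submodule.orthogonal_orthogonal]
  have hmem : WithLp.toLp 2 r ∈ LinearMap.range T := by
    rw [hrange, Submodule.mem_orthogonal]
    intro k hk
    have h0 := hT k k
    rw [LinearMap.mem_ker.mp hk, inner_zero_left] at h0
    have p₀ : 0 ≤ ∑ f, (k f - k (S.ρ₀ f)) * (k f - k (S.ρ₀ f)) :=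
      Finset.sum_nonneg fun _ _ => mul_self_nonneg _
    have p₁ : 0 ≤ ∑ f, (k f - k (S.ρ₁ f)) * (k f - k (S.ρ₁ f)) :=
      Finset.sum_nonneg fun _ _ => mul_self_nonneg _
    have z₀ := (Finset.sum_eq_zero_iff_of_nonneg fun f _ => mul_self_nonneg _).mp
      (by linarith : ∑ f, (k f - k (S.ρ₀ f)) * (k f - k (S.ρ₀ f)) = 0)
    have z₁ := (Finset.sum_eq_zero_iff_of_nonneg fun f _ => mul_self_nonneg _).mp
      (by linarith : ∑ f, (k f - k (S.ρ₁ f)) * (k f - k (S.ρ₁ f)) = 0)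
    obtain ⟨κ, hκ⟩ := S.exists_cell_function (h := fun f => k f)
      (fun f => (sub_eq_zero.mp (mul_self_eq_zero.mp (z₁ f (Finset.mem_univ f)))).symm)
      (fun f => (sub_eq_zero.mp (mul_self_eq_zero.mp (z₀ f (Finset.mem_univ f)))).symm)
    have hκ' : ∀ f, k f = κ (S.cell f) := congrFun hκ
    rw [PiLp.inner_apply, ← Finset.sum_fiberwise _ S.cell]
    refine Finset.sum_eq_zero fun i _ => ?_
    rw [Finset.sum_congr rfl (g := fun f => κ i * r f) fun f hf => by
      simp [hκ', (Finset.mem_filter.mp hf).2, mul_comm], ← Finset.mul_sum, hr, mul_zero]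
  obtain ⟨g, hg⟩ := hmem
  exact ⟨g, fun f => congrArg (fun v : EuclideanSpace ℝ F => v f) hg⟩

/-- The edge fluxes fix `s₂`, the divergence theorem fixes `d`, and a graph potential `g` supplies
inner fluxes with this divergence. Adding rotated gradients of centre hat functions then corrects
the curl without changing edge fluxes or divergence. -/
theorem exists_mem_V1 [Fintype F] [Fintype C] (Φ : E → ℝ) :
    ∃ u ∈ S.V1, ∀ e, S.edgeFlux e u = Φ e := by
  classical
  let s₂ : F → ℝ := fun f => -(S.hd f * S.len f / S.edgeLen f * Φ (S.edge f))
  have h₂ : ∀ f, s₂ (S.ρ₂ f) = s₂ f := fun f => by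
    simp only [s₂, hd_ρ₂, len_ρ₂, edgeLen_ρ₂, edge_ρ₂]
  -- The only constant divergence compatible with the edge fluxes; it makes the right-hand side
  -- below sum to zero on each cell.
  let d : C → ℝ := fun i => -(∑ f with S.cell f = i, S.sg f * s₂ f) / S.cellArea i
  obtain ⟨g, hg⟩ := S.exists_graph_laplace_solution
    (fun f => -(S.area f * d (S.cell f)) - S.sg f * s₂ f) (fun i => by
      rw [Finset.sum_sub_distrib, Finset.sum_neg_distrib,
        Finset.sum_congr rfl (g := fun f => S.area f * d i) fun f hf => by
          rw [(Finset.mem_filter.mp hf).2], ← Finset.sum_mul]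
      have := (S.cellArea_pos i).ne'
      rw [show ∑ f with S.cell f = i, S.area f = S.cellArea i by
        rw [cellArea]]
      simp only [d]
      field_simp
      ring)
  -- A potential difference is odd under the reflection, and so is `sg`; the product is even, as
  -- normal continuity requires.
  let s₀ : F → ℝ := fun f => S.sg f * (g f - g (S.ρ₀ f))
  let s₁ : F → ℝ := fun f => S.sg f * (g f - g (S.ρ₁ f))
  have h₀ : ∀ f, s₀ (S.ρ₀ f) = s₀ f := fun f => by
    simp only [s₀, sg_ρ₀, S.ρ₀_invol]; ring
  have h₁ : ∀ f, s₁ (S.ρ₁ f) = s₁ f := fun f => by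
    simp only [s₁, sg_ρ₁, S.ρ₁_invol]; ring
  have a₀ := S.affineVector_rt s₀ s₁ s₂
  have hrt : S.rt s₀ s₁ s₂ ∈ S.RT0 := by
    rw [mem_RT0_iff]
    simp only [flux₀_rt, flux₁_rt, flux₂_rt]
    exact ⟨a₀, h₀, h₁, h₂⟩
  -- Chosen to solve the moment equation of the corrected field.
  let k : C → ℝ := fun i => -S.moment (fun f => -rot (S.rt s₀ s₁ s₂ f (S.cen f))) i /
    S.moment (S.lagGrad 0 0 1) i
  have hη : S.lagrange 0 0 (k ∘ S.cell) ∈ S.P1 := ((S.mem_P1Zero_iff _).mpr ⟨k, rfl⟩).1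
  have aη := affineVector_gradPerp hη.1
  have hu : S.rt s₀ s₁ s₂ + gradPerp (S.lagrange 0 0 (k ∘ S.cell)) ∈ S.RT0 :=
    S.add_mem_RT0 hrt (S.gradPerp_mem_RT0 hη)
  have hflux : ∀ f, S.flux₂ (S.rt s₀ s₁ s₂ + gradPerp (S.lagrange 0 0 (k ∘ S.cell))) f = s₂ f := by
    intro f
    rw [flux₂_add, Pi.add_apply, flux₂_rt, S.flux₂_gradPerp hη.1, lagrange_pt₀, lagrange_pt₁]
    simp
  obtain ⟨T, hT⟩ := S.exists_edge_function S.edgeLen_ρ₀ S.edgeLen_ρ₂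
  refine ⟨_, (S.mem_V1_iff _).mpr ⟨hu, ⟨fun e => Φ e / T e, fun f => ?_⟩, ⟨d, fun f => ?_⟩, fun i => ?_⟩, fun e => ?_⟩
  · beta_reduce
    rw [hflux, show T (S.edge f) = S.edgeLen f from (congrFun hT f).symm]
    have := (S.len_pos f).ne'
    have := (S.edgeLen_pos f).ne'
    have hs := S.hd_mul_self f
    simp only [s₂]
    field_simp
    linear_combination Φ (S.edge f) * hs
  · rw [AffineVector.div_add a₀ aη, Pi.add_apply, Pi.add_apply, div_rt, S.div_eq_flux aη,
      S.flux₀_gradPerp hη.1, S.flux₁_gradPerp hη.1, S.flux₂_gradPerp hη.1]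
    have hj := S.jac_ne_zero f
    have hs := S.sg_mul_self f
    have := hg f
    rw [area] at this
    simp only [s₀, s₁]
    field_simp
    linear_combination (-2 * S.sg f) * this +
      (d (S.cell f) * S.jac f + 2 * s₂ f) * hs
  · have : (fun f => -rot ((S.rt s₀ s₁ s₂ + gradPerp (S.lagrange 0 0 (k ∘ S.cell))) f (S.cen f))) =
        (fun f => -rot (S.rt s₀ s₁ s₂ f (S.cen f))) +
          fun f => k (S.cell f) • S.lagGrad 0 0 1 f := by
      funext f
      simp only [Pi.add_apply, rot_add, neg_add, gradPerp_lagrange, rot_rot, neg_neg,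
        S.lagGrad_smul _ k rfl]
    rw [this, moment_add, moment_cell_smul]
    have := (S.moment_self_pos i).ne'
    simp only [k]
    field_simp
    ring
  · rw [S.edgeFlux_eq hu.1]
    simp only [hflux]
    obtain ⟨f, rfl⟩ := S.edge_surj e
    rw [S.sum_left_of_invariant f (fun g => by rw [h₂, hd_ρ₂])]
    simp only [s₂, hd_ρ₀, edge_ρ₀, edgeLen_ρ₀]
    have := (S.edgeLen_pos f).ne'
    have hs := S.hd_mul_self f
    field_simp
    rw [pow_two, hs, edgeLen]
    ring

/-- Interpolate linearly along each edge, then choose the centre values to solve the moment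
equations. -/
theorem exists_mem_V0 [Fintype F] (κ : V → ℝ) :
    ∃ q ∈ S.V0, ∀ f, q f (S.pt₀ f) = κ (S.vtx f) := by
  -- Linear interpolation at the edge point: each end value is weighted by the length of the
  -- opposite half.
  obtain ⟨k₁, hk₁⟩ := S.exists_edge_function (h := fun f =>
    (S.len (S.ρ₀ f) * κ (S.vtx f) + S.len f * κ (S.vtx (S.ρ₀ f))) / S.edgeLen f)
    (fun f => by rw [S.ρ₀_invol, edgeLen_ρ₀]; ring)
    (fun f => by rw [vtx_ρ₀_ρ₂, edgeLen_ρ₂, vtx_ρ₂, len_ρ₂, S.ρ_comm, len_ρ₂])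
  -- The slope along the whole edge.
  obtain ⟨c, hc⟩ := S.exists_edge_function (h := fun f =>
    S.hd f * (κ (S.vtx f) - κ (S.vtx (S.ρ₀ f))) / S.edgeLen f)
    (fun f => by rw [S.ρ₀_invol, edgeLen_ρ₀, hd_ρ₀]; ring)
    (fun f => by rw [vtx_ρ₀_ρ₂, edgeLen_ρ₂, vtx_ρ₂, hd_ρ₂])
  let k₂ : C → ℝ := fun i => -S.moment (S.lagGrad (κ ∘ S.vtx) (k₁ ∘ S.edge) 0) i /
    S.moment (S.lagGrad 0 0 1) i
  have h₁ : S.lagrange (κ ∘ S.vtx) (k₁ ∘ S.edge) 0 ∈ S.P1 :=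
    (S.mem_P1_iff _).mpr ⟨κ, k₁, 0, rfl⟩
  have h₂ : S.lagrange 0 0 (k₂ ∘ S.cell) ∈ S.P1 := ((S.mem_P1Zero_iff _).mpr ⟨k₂, rfl⟩).1
  refine ⟨S.lagrange (κ ∘ S.vtx) (k₁ ∘ S.edge) 0 + S.lagrange 0 0 (k₂ ∘ S.cell),
    (S.mem_V0_iff _).mpr ⟨S.add_mem_P1 h₁ h₂, ⟨c, fun f => ?_⟩, fun i => ?_⟩, fun f => ?_⟩
  · rw [show c (S.edge f) = _ from (congrFun hc f).symm]
    simp only [Pi.add_apply, lagrange_pt₀, lagrange_pt₁]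
    rw [show (k₁ ∘ S.edge) f = _ from (congrFun hk₁ f).symm]
    have := (S.edgeLen_pos f).ne'
    have := (S.len_pos f).ne'
    simp only [Function.comp, Pi.zero_apply, add_zero]
    field_simp
    rw [edgeLen]
    ring
  · rw [AffineScalar.grad_add h₁.1 h₂.1]
    have : (fun f => (grad (S.lagrange (κ ∘ S.vtx) (k₁ ∘ S.edge) 0) +
        grad (S.lagrange 0 0 (k₂ ∘ S.cell))) f (S.cen f)) =
        S.lagGrad (κ ∘ S.vtx) (k₁ ∘ S.edge) 0 + fun f => k₂ (S.cell f) • S.lagGrad 0 0 1 f := by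
      funext f
      simp only [Pi.add_apply, grad_lagrange, S.lagGrad_smul _ k₂ rfl]
    rw [this, moment_add, moment_cell_smul]
    have := (S.moment_self_pos i).ne'
    simp only [k₂]
    field_simp
    ring
  · simp [lagrange_pt₀]

end Mesh

namespace Mesh

variable {F V E C : Type*} (S : Mesh F V E C)

/-! ### Duality -/

theorem ContAcross.swap {ρ : F → F} {A B : F → Plane} {q : SField F} (h : ContAcross ρ A B q) :
    ContAcross ρ B A q := fun f t ht => by
  have := h f (1 - t) ⟨by linarith [ht.2], by linarith [ht.1]⟩
  rwa [AffineMap.lineMap_apply_one_sub, AffineMap.lineMap_apply_one_sub] at this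

/-- Continuity on the supermesh does not distinguish the roles of the corners. This is what lets
functions of one mesh be integrated by parts against fields of the other. -/
theorem dual_P1 : S.dual.P1 = S.P1 := by
  ext q
  exact ⟨fun h => ⟨h.1, h.2.2.2.swap, h.2.2.1.swap, h.2.1.swap⟩,
    fun h => ⟨h.1, ContAcross.swap h.2.2.2, ContAcross.swap h.2.2.1, ContAcross.swap h.2.1⟩⟩

theorem dual_tri (f : F) : S.dual.tri f = S.tri f := by
  rw [tri, tri]
  congr 1
  ext x
  simp only [dual, Set.mem_insert_iff, Set.mem_singleton_iff]
  tauto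

variable [Fintype F]

theorem dual_sInner (p q : SField F) : S.dual.sInner p q = S.sInner p q := by
  simp only [sInner, dual_tri]

theorem dual_vInner (u w : VField F) : S.dual.vInner u w = S.vInner u w := by
  simp only [vInner, dual_tri]

/-- Rotating the field by a right angle exchanges normal and tangential components, so the
normalization of `w` is a flux normalization on the dual mesh. -/
theorem edgeCirculation_rot (e : E) (u : VField F) :
    S.edgeCirculation e (fun f x => rot (u f x)) = S.edgeFlux e u := by
  rw [edgeCirculation, edgeFlux]
  simp only [unitNormal, inner_rot_left, inner_neg_right]

/-! ### Uniqueness -/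

theorem eq_of_mem_V0 {p q : SField F} (hp : p ∈ S.V0) (hq : q ∈ S.V0)
    (h : ∀ f, p f (S.pt₀ f) = q f (S.pt₀ f)) : p = q := by
  have := S.eq_zero_of_mem_V0 (S.add_mem_V0 hp (S.smul_mem_V0 (-1) hq)) fun f => by
    simp [h]
  rwa [neg_one_smul, ← sub_eq_add_neg, sub_eq_zero] at this

theorem cellIntegral_of_eq_const {q : SField F} (i : C) (c : ℝ)
    (h : ∀ f, S.cell f = i → ∀ x, q f x = c) : S.cellIntegral i q = S.cellArea i * c := by
  classical
  rw [cellIntegral, cellArea, Finset.sum_mul]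
  refine Finset.sum_congr rfl fun f hf => ?_
  simp only [h f (Finset.mem_filter.mp hf).2]
  exact S.setIntegral_tri_const f c

theorem eq_of_mem_V2 {p q : SField F} (hp : p ∈ S.V2) (hq : q ∈ S.V2)
    (h : ∀ i, S.cellIntegral i p = S.cellIntegral i q) : p = q := by
  funext f x
  obtain ⟨c, hc⟩ := hp (S.cell f)
  obtain ⟨d, hd⟩ := hq (S.cell f)
  have := h (S.cell f)
  rw [S.cellIntegral_of_eq_const _ c hc, S.cellIntegral_of_eq_const _ d hd] at this
  rw [hc f rfl, hd f rfl, mul_left_cancel₀ (S.cellArea_pos _).ne' this]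

/-! ### The normalized bases -/

/-- Normalized indicator function of a cell. -/
def cellBasis [DecidableEq C] (i : C) : SField F := fun f _ =>
  if i = S.cell f then (S.cellArea i)⁻¹ else 0

/-- The field of `V₁` with unit flux through one edge. -/
def edgeBasis [Fintype C] [DecidableEq E] (e : E) : VField F :=
  (S.exists_mem_V1 fun e' => if e = e' then 1 else 0).choose

/-- The function of `V₀` that is one at one vertex and vanishes at the others. -/
def vertexBasis [DecidableEq V] (j : V) : SField F :=
  (S.exists_mem_V0 fun j' => if j = j' then 1 else 0).choose

theorem cellBasis_mem [DecidableEq C] (i : C) : S.cellBasis i ∈ S.V2 :=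
  fun i' => ⟨if i = i' then (S.cellArea i)⁻¹ else 0, fun f hf x => by rw [cellBasis, hf]⟩

theorem cellIntegral_cellBasis [DecidableEq C] (i i' : C) :
    S.cellIntegral i' (S.cellBasis i) = if i = i' then 1 else 0 := by
  rw [S.cellIntegral_of_eq_const i' (if i = i' then (S.cellArea i)⁻¹ else 0) fun f hf x => by
    rw [cellBasis, hf]]
  split_ifs with h
  · rw [h, mul_inv_cancel₀ (S.cellArea_pos i').ne']
  · simp

theorem edgeBasis_mem [Fintype C] [DecidableEq E] (e : E) : S.edgeBasis e ∈ S.V1 :=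
  (S.exists_mem_V1 fun e' => if e = e' then 1 else 0).choose_spec.1

theorem edgeFlux_edgeBasis [Fintype C] [DecidableEq E] (e e' : E) :
    S.edgeFlux e' (S.edgeBasis e) = if e = e' then 1 else 0 :=
  (S.exists_mem_V1 fun e' => if e = e' then 1 else 0).choose_spec.2 e'

theorem vertexBasis_mem [DecidableEq V] (j : V) : S.vertexBasis j ∈ S.V0 :=
  (S.exists_mem_V0 fun j' => if j = j' then 1 else 0).choose_spec.1

theorem vertexBasis_pt₀ [DecidableEq V] (j : V) (f : F) :
    S.vertexBasis j f (S.pt₀ f) = if j = S.vtx f then 1 else 0 :=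
  (S.exists_mem_V0 fun j' => if j = j' then 1 else 0).choose_spec.2 f

theorem sum_mem_V0 {ι : Type*} (s : Finset ι) (c : ι → ℝ) {q : ι → SField F}
    (hq : ∀ i, q i ∈ S.V0) : ∑ i ∈ s, c i • q i ∈ S.V0 := by
  refine Finset.sum_induction _ (· ∈ S.V0) (fun _ _ => S.add_mem_V0) ?_
    fun i _ => S.smul_mem_V0 _ (hq i)
  obtain ⟨q, hq, -⟩ := S.exists_mem_V0 0
  simpa using S.smul_mem_V0 0 hq

theorem sum_mem_V1 [Fintype C] {ι : Type*} (s : Finset ι) (c : ι → ℝ) {u : ι → VField F}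
    (hu : ∀ i, u i ∈ S.V1) : ∑ i ∈ s, c i • u i ∈ S.V1 := by
  refine Finset.sum_induction _ (· ∈ S.V1) (fun _ _ => S.add_mem_V1) ?_
    fun i _ => S.smul_mem_V1 _ (hu i)
  obtain ⟨u, hu, -⟩ := S.exists_mem_V1 0
  simpa using S.smul_mem_V1 0 hu

omit [Fintype F] in
theorem flux₂_sum {ι : Type*} (s : Finset ι) (c : ι → ℝ) (u : ι → VField F) :
    S.flux₂ (∑ i ∈ s, c i • u i) = ∑ i ∈ s, c i • S.flux₂ (u i) := by
  let T : VField F →ₗ[ℝ] (F → ℝ) :=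
    { toFun := S.flux₂, map_add' := S.flux₂_add, map_smul' := S.flux₂_smul }
  have := map_sum T (fun i => c i • u i) s
  simp only [map_smul] at this
  exact this

theorem edgeFlux_sum_edgeBasis [Fintype C] [Fintype E] [DecidableEq E] (Φ : E → ℝ) (e : E) :
    S.edgeFlux e (∑ e', Φ e' • S.edgeBasis e') = Φ e := by
  have h := S.sum_mem_V1 Finset.univ Φ S.edgeBasis_mem
  have h' : S.edgeFlux e (∑ e', Φ e' • S.edgeBasis e') =
      ∑ e', Φ e' * S.edgeFlux e (S.edgeBasis e') := by
    rw [S.edgeFlux_eq h.1.1]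
    simp only [S.edgeFlux_eq (S.edgeBasis_mem _).1.1, Finset.mul_sum]
    rw [Finset.sum_comm]
    refine Finset.sum_congr rfl fun f _ => ?_
    rw [flux₂_sum, Finset.sum_apply, ← Finset.sum_neg_distrib, Finset.mul_sum]
    refine Finset.sum_congr rfl fun e' _ => ?_
    simp only [Pi.smul_apply, smul_eq_mul]
    ring
  rw [h']
  simp [edgeFlux_edgeBasis]

theorem eq_sum_edgeBasis [Fintype C] [Fintype E] [DecidableEq E] {u : VField F} (hu : u ∈ S.V1) :
    u = ∑ e, S.edgeFlux e u • S.edgeBasis e :=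
  S.eq_of_mem_V1 hu (S.sum_mem_V1 _ _ S.edgeBasis_mem) fun e =>
    (S.edgeFlux_sum_edgeBasis (fun e => S.edgeFlux e u) e).symm

theorem sum_vertexBasis_pt₀ [Fintype V] [DecidableEq V] (κ : V → ℝ) (f : F) :
    (∑ j, κ j • S.vertexBasis j) f (S.pt₀ f) = κ (S.vtx f) := by
  simp [Finset.sum_apply, vertexBasis_pt₀]

theorem eq_sum_vertexBasis [Fintype V] [DecidableEq V] {q : SField F} (hq : q ∈ S.V0)
    {κ : V → ℝ} (h : ∀ f, q f (S.pt₀ f) = κ (S.vtx f)) : q = ∑ j, κ j • S.vertexBasis j :=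
  S.eq_of_mem_V0 hq (S.sum_mem_V0 _ _ S.vertexBasis_mem) fun f => by
    rw [h, sum_vertexBasis_pt₀]

omit [Fintype F] in
theorem exists_vertexValues {q : SField F} (hq : q ∈ S.P1) :
    ∃ κ : V → ℝ, ∀ f, q f (S.pt₀ f) = κ (S.vtx f) := by
  obtain ⟨k₀, k₁, k₂, rfl⟩ := (S.mem_P1_iff q).mp hq
  exact ⟨k₀, fun f => S.lagrange_pt₀ _ _ _ f⟩

theorem sum_cellBasis_apply [Fintype C] [DecidableEq C] (y : C → ℝ) (f : F) (x : Plane) :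
    (∑ i, y i • S.cellBasis i) f x = y (S.cell f) * (S.cellArea (S.cell f))⁻¹ := by
  simp [Finset.sum_apply, cellBasis]

/-! ### Strong derivatives -/

omit [Fintype F] in
theorem sg_eq_side_mul_hd (f : F) : S.sg f = ((S.side f : ℤ) : ℝ) * S.hd f := by
  rcases Int.units_eq_one_or (S.head f) with h | h <;> simp [side, sg, hd, h]

/-- The divergence theorem on the cell, regrouped by edges with `sum_cell`. The sign `sg` factors
into `side`, which enters `D₂`, and `hd`, which enters the edge flux. -/
theorem div_mul_cellArea [Fintype E] {u : VField F} (hu : u ∈ S.V1) (f : F) (x : Plane) :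
    div u f x * S.cellArea (S.cell f) = (S.D₂ *ᵥ fun e => S.edgeFlux e u) (S.cell f) := by
  classical
  have hRT := hu.1
  obtain ⟨ha, -, -, h₂⟩ := (S.mem_RT0_iff u).mp hRT
  obtain ⟨-, -, ⟨d, hd⟩, -⟩ := (S.mem_V1_iff u).mp hu
  have h := S.sum_area_mul_div hRT (S.cell f)
  have e₁ : ∑ g with S.cell g = S.cell f, S.area g * div u g 0 =
      d (S.cell f) * S.cellArea (S.cell f) := by
    rw [cellArea, Finset.mul_sum]
    refine Finset.sum_congr rfl fun g hg => ?_
    rw [hd, (Finset.mem_filter.mp hg).2, mul_comm]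
  have e₂ : -∑ g with S.cell g = S.cell f, S.sg g * S.flux₂ u g =
      ∑ g with S.cell g = S.cell f, ((S.side g : ℤ) : ℝ) * (S.hd g * -S.flux₂ u g) := by
    rw [← Finset.sum_neg_distrib]
    refine Finset.sum_congr rfl fun g _ => ?_
    rw [sg_eq_side_mul_hd]; ring
  rw [e₁, e₂, S.sum_cell _ fun g => by rw [h₂, hd_ρ₂]] at h
  rw [AffineVector.div_eq ha f x 0, hd, h, Matrix.mulVec, dotProduct]
  simp only [S.edgeFlux_eq ha]

theorem div_eq_sum_cellBasis [Fintype C] [Fintype E] [DecidableEq C] {u : VField F}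
    (hu : u ∈ S.V1) : div u = ∑ i, (S.D₂ *ᵥ fun e => S.edgeFlux e u) i • S.cellBasis i := by
  funext f x
  rw [sum_cellBasis_apply, ← S.div_mul_cellArea hu f x,
    mul_inv_cancel_right₀ (S.cellArea_pos _).ne']

/-- The flux is a difference of stream function values on each half edge. The edge point values
cancel because `hd` is opposite on the two halves, leaving the end vertices. -/
theorem edgeFlux_gradPerp [Fintype V] {q : SField F} (hq : q ∈ S.P1) {κ : V → ℝ}
    (h : ∀ f, q f (S.pt₀ f) = κ (S.vtx f)) (e : E) :
    S.edgeFlux e (gradPerp q) = -(S.D₁ *ᵥ κ) e := by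
  classical
  rw [S.edgeFlux_eq (affineVector_gradPerp hq.1), ← S.sum_head_mul_vtx]
  have hv : ∀ g, S.hd g * -S.flux₂ (gradPerp q) g =
      S.hd g * q g (S.pt₁ g) - S.hd g * κ (S.vtx g) := by
    intro g
    rw [S.flux₂_gradPerp hq.1, h]; ring
  simp only [hv, Finset.sum_sub_distrib]
  rw [sum_eq_zero_of_invol S.ρ₀_invol, zero_sub]
  · intro f; rw [edge_ρ₀, side_ρ₀]
  · intro f
    obtain ⟨k₀, k₁, k₂, rfl⟩ := (S.mem_P1_iff q).mp hq
    rw [lagrange_pt₁, lagrange_pt₁, hd_ρ₀]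
    simp [edge_ρ₀]

theorem gradPerp_eq_sum_edgeBasis [Fintype V] [Fintype C] [Fintype E] [DecidableEq E]
    {q : SField F} (hq : q ∈ S.V0) {κ : V → ℝ} (h : ∀ f, q f (S.pt₀ f) = κ (S.vtx f)) :
    gradPerp q = -∑ e, (S.D₁ *ᵥ κ) e • S.edgeBasis e := by
  rw [S.eq_sum_edgeBasis (S.gradPerp_mem_V1 hq), ← Finset.sum_neg_distrib]
  simp only [S.edgeFlux_gradPerp hq.1 h, neg_smul]

end Mesh

/-! ### Matrices of bilinear forms -/

theorem isUnit_of_dotProduct_mulVec {ι : Type*} [Fintype ι] [DecidableEq ι] {A : Matrix ι ι ℝ}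
    (h : ∀ x, x ⬝ᵥ A *ᵥ x = 0 → x = 0) : IsUnit A := by
  rw [← Matrix.mulVec_injective_iff_isUnit]
  intro x y hxy
  refine sub_eq_zero.mp (h _ ?_)
  rw [Matrix.mulVec_sub, sub_eq_zero.mpr hxy, dotProduct_zero]

theorem mulVec_eq_iff_eq_inv_mulVec {ι : Type*} [Fintype ι] [DecidableEq ι] {A : Matrix ι ι ℝ}
    (hA : IsUnit A) (x y : ι → ℝ) : A *ᵥ x = y ↔ x = A⁻¹ *ᵥ y := by
  rw [Matrix.isUnit_iff_isUnit_det] at hA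
  constructor
  · rintro rfl
    rw [Matrix.mulVec_mulVec, Matrix.nonsing_inv_mul _ hA, Matrix.one_mulVec]
  · rintro rfl
    rw [Matrix.mulVec_mulVec, Matrix.mul_nonsing_inv _ hA, Matrix.one_mulVec]

theorem continuous_sum_smul {F ι X : Type*} [NormedAddCommGroup X] [NormedSpace ℝ X] [Fintype ι]
    {q : ι → F → Plane → X} (hq : ∀ i f, Continuous (q i f)) (y : ι → ℝ) (f : F) :
    Continuous ((∑ k, y k • q k) f) := by
  have h : (∑ k, y k • q k) f = fun x => ∑ k, y k • q k f x := by
    funext x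
    simp [Finset.sum_apply]
  rw [h]
  exact continuous_finsetSum _ fun k _ => continuous_const.smul (hq k f)

namespace Mesh

variable {F V E C : Type*} (S : Mesh F V E C) [Fintype F]

theorem sInner_sum_sum {ι κ : Type*} [Fintype ι] [Fintype κ] {p : ι → SField F} {q : κ → SField F}
    (hp : ∀ i f, Continuous (p i f)) (hq : ∀ i f, Continuous (q i f)) (x : ι → ℝ) (y : κ → ℝ) :
    S.sInner (∑ i, x i • p i) (∑ k, y k • q k) =
      x ⬝ᵥ (Matrix.of fun i k => S.sInner (p i) (q k)) *ᵥ y := by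
  rw [S.sum_smul_sInner _ (continuous_sum_smul hq y) x p hp]
  refine Finset.sum_congr rfl fun i _ => ?_
  rw [S.sInner_sum_smul _ (hp i) y q hq]
  congr 1
  exact Finset.sum_congr rfl fun k _ => mul_comm _ _

theorem vInner_sum_sum {ι κ : Type*} [Fintype ι] [Fintype κ] {u : ι → VField F} {w : κ → VField F}
    (hu : ∀ i f, Continuous (u i f)) (hw : ∀ i f, Continuous (w i f)) (x : ι → ℝ) (y : κ → ℝ) :
    S.vInner (∑ i, x i • u i) (∑ k, y k • w k) =
      x ⬝ᵥ (Matrix.of fun i k => S.vInner (u i) (w k)) *ᵥ y := by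
  rw [S.sum_smul_vInner _ (continuous_sum_smul hw y) x u hu]
  refine Finset.sum_congr rfl fun i _ => ?_
  rw [S.vInner_sum_smul _ (hu i) y w hw]
  congr 1
  exact Finset.sum_congr rfl fun k _ => mul_comm _ _

theorem continuous_cellBasis [DecidableEq C] (i : C) (f : F) : Continuous (S.cellBasis i f) :=
  continuous_const

theorem continuous_edgeBasis [Fintype C] [DecidableEq E] (e : E) (f : F) :
    Continuous (S.edgeBasis e f) :=
  AffineVector.continuous (S.edgeBasis_mem e).1.1 f

theorem continuous_vertexBasis [DecidableEq V] (j : V) (f : F) :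
    Continuous (S.vertexBasis j f) :=
  AffineScalar.continuous (S.vertexBasis_mem j).1.1 f

/-! ### Mass matrices -/

/-- A combination of norm zero vanishes on every closed facet, and its coefficients can be read off
there. The other two mass matrices are treated in the same way. -/
theorem isUnit_cellMass [Fintype C] [DecidableEq C] :
    IsUnit (Matrix.of fun i i' => S.sInner (S.cellBasis i) (S.cellBasis i')) := by
  refine isUnit_of_dotProduct_mulVec fun x hx => funext fun i => ?_
  rw [← S.sInner_sum_sum S.continuous_cellBasis S.continuous_cellBasis] at hx
  obtain ⟨f, rfl⟩ := S.cell_surj i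
  have := S.eq_zero_of_sInner_self (continuous_sum_smul S.continuous_cellBasis x) hx f
    (S.pt₀_mem_tri f)
  rw [sum_cellBasis_apply] at this
  exact (mul_eq_zero.mp this).resolve_right (inv_ne_zero (S.cellArea_pos _).ne')

theorem isUnit_vertexMass [Fintype V] [DecidableEq V] :
    IsUnit (Matrix.of fun j j' => S.sInner (S.vertexBasis j) (S.vertexBasis j')) := by
  refine isUnit_of_dotProduct_mulVec fun x hx => funext fun j => ?_
  rw [← S.sInner_sum_sum S.continuous_vertexBasis S.continuous_vertexBasis] at hx
  obtain ⟨f, rfl⟩ := S.vtx_surj j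
  have := S.eq_zero_of_sInner_self
    (AffineScalar.continuous (S.sum_mem_V0 _ _ S.vertexBasis_mem).1.1) hx f (S.pt₀_mem_tri f)
  rwa [sum_vertexBasis_pt₀] at this

theorem isUnit_edgeMass [Fintype C] [Fintype E] [DecidableEq E] :
    IsUnit (Matrix.of fun e e' => S.vInner (S.edgeBasis e) (S.edgeBasis e')) := by
  refine isUnit_of_dotProduct_mulVec fun x hx => funext fun e => ?_
  rw [← S.vInner_sum_sum S.continuous_edgeBasis S.continuous_edgeBasis] at hx
  have hm := (S.sum_mem_V1 Finset.univ x S.edgeBasis_mem).1.1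
  rw [← S.edgeFlux_sum_edgeBasis x e, S.edgeFlux_eq hm]
  refine Finset.sum_eq_zero fun f _ => ?_
  -- The coefficient is an edge flux, and `flux₂` only sees the field at `pt₀`, which lies in the
  -- closed facet.
  rw [flux₂, S.eq_zero_of_vInner_self (AffineVector.continuous hm) hx f (S.pt₀_mem_tri f)]
  simp [cross]

/-! ### Weak derivatives -/

/-- Testing with coefficients `y` puts `D₂ y` into the divergence; moving the matrix to the other
side gives `-D₂ᵀ = D₁bar`. The basis spans `V1`, so all test fields are covered. -/
theorem isWeakGrad_iff [Fintype C] [Fintype E] [DecidableEq C] [DecidableEq E] (Φ : C → ℝ)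
    (G : E → ℝ) :
    S.IsWeakGrad (∑ i, Φ i • S.cellBasis i) (∑ e, G e • S.edgeBasis e) ↔
      (Matrix.of fun e e' => S.vInner (S.edgeBasis e) (S.edgeBasis e')) *ᵥ G =
        S.D₁bar *ᵥ (Matrix.of fun i i' => S.sInner (S.cellBasis i) (S.cellBasis i')) *ᵥ Φ := by
  have key : ∀ y : E → ℝ,
      (S.vInner (∑ e, y e • S.edgeBasis e) (∑ e, G e • S.edgeBasis e) =
        -S.sInner (div (∑ e, y e • S.edgeBasis e)) (∑ i, Φ i • S.cellBasis i)) ↔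
      y ⬝ᵥ (Matrix.of fun e e' => S.vInner (S.edgeBasis e) (S.edgeBasis e')) *ᵥ G =
        y ⬝ᵥ S.D₁bar *ᵥ
          (Matrix.of fun i i' => S.sInner (S.cellBasis i) (S.cellBasis i')) *ᵥ Φ := by
    intro y
    rw [S.vInner_sum_sum S.continuous_edgeBasis S.continuous_edgeBasis,
      S.div_eq_sum_cellBasis (S.sum_mem_V1 _ _ S.edgeBasis_mem),
      S.sInner_sum_sum S.continuous_cellBasis S.continuous_cellBasis, D₁bar, Matrix.neg_mulVec,
      dotProduct_neg, Matrix.dotProduct_mulVec y S.D₂ᵀ, Matrix.vecMul_transpose]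
    simp only [edgeFlux_sum_edgeBasis]
  constructor
  · rintro ⟨-, h⟩
    refine dotProduct_eq _ _ fun y => ?_
    rw [dotProduct_comm, (key y).mp (h _ (S.sum_mem_V1 _ _ S.edgeBasis_mem)), dotProduct_comm]
  · intro h
    refine ⟨S.sum_mem_V1 _ _ S.edgeBasis_mem, fun u hu => ?_⟩
    rw [S.eq_sum_edgeBasis hu, key, h]

/-- The rotated gradient of a test function has coefficients `-D₁ y`. Its sign cancels the one in
the weak curl, and the transpose is `D₂bar`. -/
theorem isWeakCurl_iff [Fintype V] [Fintype C] [Fintype E] [DecidableEq V] [DecidableEq E]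
    (U : E → ℝ) (Ξ : V → ℝ) :
    S.IsWeakCurl (∑ e, U e • S.edgeBasis e) (∑ j, Ξ j • S.vertexBasis j) ↔
      (Matrix.of fun j j' => S.sInner (S.vertexBasis j) (S.vertexBasis j')) *ᵥ Ξ =
        S.D₂bar *ᵥ (Matrix.of fun e e' => S.vInner (S.edgeBasis e) (S.edgeBasis e')) *ᵥ U := by
  have key : ∀ y : V → ℝ,
      (S.sInner (∑ j, y j • S.vertexBasis j) (∑ j, Ξ j • S.vertexBasis j) =
        -S.vInner (gradPerp (∑ j, y j • S.vertexBasis j)) (∑ e, U e • S.edgeBasis e)) ↔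
      y ⬝ᵥ (Matrix.of fun j j' => S.sInner (S.vertexBasis j) (S.vertexBasis j')) *ᵥ Ξ =
        y ⬝ᵥ S.D₂bar *ᵥ
          (Matrix.of fun e e' => S.vInner (S.edgeBasis e) (S.edgeBasis e')) *ᵥ U := by
    intro y
    rw [S.sInner_sum_sum S.continuous_vertexBasis S.continuous_vertexBasis,
      S.gradPerp_eq_sum_edgeBasis (S.sum_mem_V0 _ _ S.vertexBasis_mem) (S.sum_vertexBasis_pt₀ y),
      ← Finset.sum_neg_distrib]
    simp only [← neg_smul]
    rw [S.vInner_sum_sum S.continuous_edgeBasis S.continuous_edgeBasis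
      (fun e => -(S.D₁ *ᵥ y) e), show (fun e => -(S.D₁ *ᵥ y) e) = -(S.D₁ *ᵥ y) from rfl,
      neg_dotProduct, neg_neg, D₂bar, Matrix.dotProduct_mulVec y S.D₁ᵀ, Matrix.vecMul_transpose]
  constructor
  · rintro ⟨-, h⟩
    refine dotProduct_eq _ _ fun y => ?_
    rw [dotProduct_comm, (key y).mp (h _ (S.sum_mem_V0 _ _ S.vertexBasis_mem)), dotProduct_comm]
  · intro h
    refine ⟨S.sum_mem_V0 _ _ S.vertexBasis_mem, fun ψ hψ => ?_⟩
    obtain ⟨κ, hκ⟩ := S.exists_vertexValues hψ.1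
    rw [S.eq_sum_vertexBasis hψ hκ, key, h]

/-! ### The six bases, and the strong derivatives of the dual spaces -/

variable [Fintype V] [Fintype E] [Fintype C] [DecidableEq V] [DecidableEq E] [DecidableEq C]

/-- The normalized bases. -/
def basis : S.Basis where
  α := S.cellBasis
  v := S.edgeBasis
  γ := S.vertexBasis
  β := S.dual.cellBasis
  w e f x := rot (S.dual.edgeBasis e f x)
  χ := S.dual.vertexBasis
  α_mem := S.cellBasis_mem
  v_mem := S.edgeBasis_mem
  γ_mem := S.vertexBasis_mem
  β_mem := S.dual.cellBasis_mem
  w_mem e := ⟨_, S.dual.edgeBasis_mem e, fun _ _ => rfl⟩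
  χ_mem := S.dual.vertexBasis_mem
  α_norm := S.cellIntegral_cellBasis
  v_norm := S.edgeFlux_edgeBasis
  γ_norm j j' f h := by rw [vertexBasis_pt₀, h]
  β_norm := S.dual.cellIntegral_cellBasis
  w_norm e e' := by rw [edgeCirculation_rot, edgeFlux_edgeBasis]
  χ_norm i i' f h := by
    have := S.dual.vertexBasis_pt₀ i f
    rwa [show S.dual.vtx f = i' from h] at this

omit [Fintype E] in
theorem basis_unique (B : S.Basis) : B = S.basis := by
  have hα : B.α = S.cellBasis := funext fun i =>
    S.eq_of_mem_V2 (B.α_mem i) (S.cellBasis_mem i) fun i' => by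
      rw [B.α_norm, cellIntegral_cellBasis]
  have hv : B.v = S.edgeBasis := funext fun e =>
    S.eq_of_mem_V1 (B.v_mem e) (S.edgeBasis_mem e) fun e' => by
      rw [B.v_norm, edgeFlux_edgeBasis]
  have hγ : B.γ = S.vertexBasis := funext fun j =>
    S.eq_of_mem_V0 (B.γ_mem j) (S.vertexBasis_mem j) fun f => by
      rw [B.γ_norm j _ f rfl, vertexBasis_pt₀]
  have hβ : B.β = S.dual.cellBasis := funext fun j =>
    S.dual.eq_of_mem_V2 (B.β_mem j) (S.dual.cellBasis_mem j) fun j' => by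
      rw [B.β_norm, cellIntegral_cellBasis]
  have hχ : B.χ = S.dual.vertexBasis := funext fun i =>
    S.dual.eq_of_mem_V0 (B.χ_mem i) (S.dual.vertexBasis_mem i) fun f =>
      (B.χ_norm i _ f rfl).trans (S.dual.vertexBasis_pt₀ i f).symm
  -- Uniqueness is inherited from the field of the dual mesh before rotation, whose edge fluxes are
  -- the circulations of `w`.
  have hw : B.w = fun e f x => rot (S.dual.edgeBasis e f x) := by
    funext e
    obtain ⟨u, hu, h⟩ := B.w_mem e
    have hw : B.w e = fun f x => rot (u f x) := funext fun f => funext fun x => h f x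
    have : u = S.dual.edgeBasis e :=
      S.dual.eq_of_mem_V1 hu (S.dual.edgeBasis_mem e) fun e' => by
        rw [edgeFlux_edgeBasis, ← B.w_norm, hw, edgeCirculation_rot]
    rw [hw, this]
  cases B
  simp only at hα hv hγ hβ hw hχ
  subst hα hv hγ hβ hw hχ
  rfl

theorem sum_basis_w (U : E → ℝ) :
    ∑ e, U e • S.basis.w e = fun f x => rot ((∑ e, U e • S.dual.edgeBasis e) f x) := by
  funext f x
  simp only [Finset.sum_apply, Pi.smul_apply, ← rotL_apply, map_sum, map_smul]
  rfl

/-- The formula for `gradPerp` on the dual mesh, rotated once more; the sign from the double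
rotation cancels the sign in that formula. -/
theorem grad_sum_basis_χ (P : C → ℝ) :
    grad (∑ i, P i • S.basis.χ i) = ∑ e, (S.D₁bar *ᵥ P) e • S.basis.w e := by
  have h := S.dual.gradPerp_eq_sum_edgeBasis
    (S.dual.sum_mem_V0 Finset.univ P S.dual.vertexBasis_mem) (S.dual.sum_vertexBasis_pt₀ P)
  rw [sum_basis_w, D₁bar_eq]
  funext f x
  rw [show ∑ e, (S.dual.D₁ *ᵥ P) e • S.dual.edgeBasis e = -gradPerp (∑ i, P i • S.basis.χ i) by
    rw [← neg_eq_iff_eq_neg]; exact h.symm]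
  rw [Pi.neg_apply, Pi.neg_apply, ← rotL_apply, map_neg, rotL_apply, gradPerp, rot_rot, neg_neg]

theorem curl_sum_basis_w (U : E → ℝ) :
    curl (∑ e, U e • S.basis.w e) = ∑ j, (S.D₂bar *ᵥ U) j • S.basis.β j := by
  have hm := S.dual.sum_mem_V1 Finset.univ U S.dual.edgeBasis_mem
  rw [sum_basis_w, AffineVector.curl_rot hm.1.1, S.dual.div_eq_sum_cellBasis hm, D₂bar_eq]
  simp only [edgeFlux_sum_edgeBasis]
  rfl

/-! ### The Hodge stars commute with the derivatives -/

omit [Fintype E] in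
theorem continuous_basis_w (e : E) (f : F) : Continuous (S.basis.w e f) :=
  rotL.continuous.comp (S.dual.continuous_edgeBasis e f)

/-- Integration by parts of a primal field in `V1` with coefficients `y` against a dual function
with coefficients `P`: the two terms are `(D₂ y) · I P` and `y · H D₁bar P`. -/
theorem D₁bar_mul_I : S.D₁bar * S.basis.I = S.basis.H * S.D₁bar := by
  refine Matrix.ext_of_mulVec_single fun i => ?_
  set P : C → ℝ := Pi.single i 1
  rw [← Matrix.mulVec_mulVec, ← Matrix.mulVec_mulVec]
  refine (dotProduct_eq _ _ fun y => ?_).symm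
  rw [dotProduct_comm, dotProduct_comm _ y]
  have hv := S.sum_mem_V1 Finset.univ y S.edgeBasis_mem
  have hχ := (S.dual.sum_mem_V0 Finset.univ P S.dual.vertexBasis_mem).1
  rw [dual_P1] at hχ
  have h := S.sInner_div_add_vInner_grad hv.1 hχ
  have hg : grad (∑ i, P i • S.dual.vertexBasis i) = _ := S.grad_sum_basis_χ P
  rw [hg, S.div_eq_sum_cellBasis hv,
    S.vInner_sum_sum S.continuous_edgeBasis S.continuous_basis_w,
    S.sInner_sum_sum S.continuous_cellBasis S.dual.continuous_vertexBasis] at h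
  simp only [edgeFlux_sum_edgeBasis] at h
  have hD : S.D₁bar *ᵥ S.basis.I *ᵥ P = -(S.D₂ᵀ *ᵥ S.basis.I *ᵥ P) := by
    rw [D₁bar, Matrix.neg_mulVec]
  rw [hD, dotProduct_neg, Matrix.dotProduct_mulVec y S.D₂ᵀ, Matrix.vecMul_transpose]
  exact (neg_eq_of_add_eq_zero_right h).symm

/-- Integration by parts on the dual mesh, of the field before rotation against a primal function in
`V0`. -/
theorem D₂bar_mul_H : S.D₂bar * S.basis.H = S.basis.J * S.D₂bar := by
  refine Matrix.ext_of_mulVec_single fun e => ?_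
  set U : E → ℝ := Pi.single e 1
  rw [← Matrix.mulVec_mulVec, ← Matrix.mulVec_mulVec]
  refine dotProduct_eq _ _ fun y => ?_
  rw [dotProduct_comm, dotProduct_comm _ y]
  have hu := S.dual.sum_mem_V1 Finset.univ U S.dual.edgeBasis_mem
  have hγ := S.sum_mem_V0 Finset.univ y S.vertexBasis_mem
  have h := S.dual.sInner_div_add_vInner_grad hu.1 (S.dual_P1 ▸ hγ.1)
  rw [dual_sInner, dual_vInner, ← AffineVector.curl_rot hu.1.1, ← sum_basis_w, curl_sum_basis_w,
    sInner_comm, show S.basis.β = S.dual.cellBasis from rfl,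
    S.sInner_sum_sum S.continuous_vertexBasis S.dual.continuous_cellBasis] at h
  -- Rotation is an isometry, so both factors may be rotated at once; this brings in `w` and the
  -- rotated gradient.
  have h' : S.vInner (∑ e, U e • S.dual.edgeBasis e) (grad (∑ j, y j • S.vertexBasis j)) =
      S.vInner (gradPerp (∑ j, y j • S.vertexBasis j)) (∑ e, U e • S.basis.w e) := by
    rw [vInner_comm, sum_basis_w]
    simp only [vInner, gradPerp, inner_rot_rot]
  rw [h', S.gradPerp_eq_sum_edgeBasis hγ (S.sum_vertexBasis_pt₀ y), ← Finset.sum_neg_distrib] at h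
  simp only [← neg_smul] at h
  rw [S.vInner_sum_sum S.continuous_edgeBasis S.continuous_basis_w (fun e => -(S.D₁ *ᵥ y) e),
    show (fun e => -(S.D₁ *ᵥ y) e) = -(S.D₁ *ᵥ y) from rfl, neg_dotProduct,
    ← sub_eq_add_neg, sub_eq_zero] at h
  refine Eq.trans ?_ h.symm
  rw [D₂bar, Matrix.dotProduct_mulVec y S.D₁ᵀ, Matrix.vecMul_transpose]
  rfl

end Mesh

end CompoundFE

end

/-! ### Assembly -/

theorem mainTheorem5 {F V E C : Type*} [Fintype F] [Fintype V] [Fintype E] [Fintype C]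
    [DecidableEq V] [DecidableEq E] [DecidableEq C] (S : CompoundFE.Mesh F V E C) :
    ∃ B : S.Basis, (∀ B' : S.Basis, B' = B) ∧
      -- the Hodge stars commute with the strong derivatives of the dual spaces
      S.D₂bar * B.H = B.J * S.D₂bar ∧
      S.D₁bar * B.I = B.H * S.D₁bar ∧
      -- the two matrices do represent these strong derivatives
      (∀ Phat : C → ℝ,
        CompoundFE.grad (∑ i, Phat i • B.χ i) = ∑ e, (S.D₁bar *ᵥ Phat) e • B.w e) ∧
      (∀ Uhat : E → ℝ,
        CompoundFE.curl (∑ e, Uhat e • B.w e) = ∑ j, (S.D₂bar *ᵥ Uhat) j • B.β j) ∧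
      -- the mass matrices are invertible, and the weak derivatives have the expected matrices
      IsUnit B.L ∧ IsUnit B.M ∧ IsUnit B.N ∧
      (∀ (Φ : C → ℝ) (G : E → ℝ),
        S.IsWeakGrad (∑ i, Φ i • B.α i) (∑ e, G e • B.v e) ↔
          G = (B.M⁻¹ * S.D₁bar * B.L) *ᵥ Φ) ∧
      (∀ (U : E → ℝ) (Ξ : V → ℝ),
        S.IsWeakCurl (∑ e, U e • B.v e) (∑ j, Ξ j • B.γ j) ↔
          Ξ = (B.N⁻¹ * S.D₂bar * B.M) *ᵥ U) ∧
      -- weak derivative = Hodge star, dual strong derivative, Hodge star back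
      (IsUnit B.I →
        B.M⁻¹ * S.D₁bar * B.L = (B.M⁻¹ * B.H) * S.D₁bar * (B.I⁻¹ * B.L)) ∧
      (IsUnit B.H →
        B.N⁻¹ * S.D₂bar * B.M = (B.N⁻¹ * B.J) * S.D₂bar * (B.H⁻¹ * B.M)) := by
  have hM : IsUnit S.basis.M := S.isUnit_edgeMass
  have hN : IsUnit S.basis.N := S.isUnit_vertexMass
  refine ⟨S.basis, S.basis_unique, S.D₂bar_mul_H, S.D₁bar_mul_I, S.grad_sum_basis_χ,
    S.curl_sum_basis_w, S.isUnit_cellMass, hM, hN, fun Φ G => ?_, fun U Ξ => ?_,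
    fun hI => ?_, fun hH => ?_⟩
  · rw [← Matrix.mulVec_mulVec, ← Matrix.mulVec_mulVec, ← CompoundFE.mulVec_eq_iff_eq_inv_mulVec hM]
    exact S.isWeakGrad_iff Φ G
  · rw [← Matrix.mulVec_mulVec, ← Matrix.mulVec_mulVec, ← CompoundFE.mulVec_eq_iff_eq_inv_mulVec hN]
    exact S.isWeakCurl_iff U Ξ
  -- The commutation relation moves the Hodge star next to its inverse, where the two cancel; the
  -- curl case is analogous.
  · rw [Matrix.mul_assoc _ S.basis.H, ← S.D₁bar_mul_I]
    simp only [Matrix.mul_assoc]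
    rw [Matrix.mul_nonsing_inv_cancel_left _ _ ((Matrix.isUnit_iff_isUnit_det _).mp hI)]
  · rw [Matrix.mul_assoc _ S.basis.J, ← S.D₂bar_mul_H]
    simp only [Matrix.mul_assoc]
    rw [Matrix.mul_nonsing_inv_cancel_left _ _ ((Matrix.isUnit_iff_isUnit_det _).mp hH)]
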